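/- All random variables are discrete with finite range, and $H$ is Shannon entropy (logarithms to base $2$). Write $H(C|A,B)=H(A,B,C)-H(A,B)$, $I(A:B)=H(A)+H(B)-H(A,B)$, $I(A:B|C)=H(A,C)+H(B,C)-H(A,B,C)-H(C)$ and $$\square_{AB,CD}=I(C:D|A)+I(C:D|B)+I(A:B)-I(C:D).$$ Let $\alpha,\beta_1,\dots,\beta_m$ be linear functions, with real coefficients, of the entropies of the nonempty subtuples of $n$ jointly distributed random variables. The implication "$\beta_1=\dots=\beta_m=0\Rightarrow\alpha\ge 0$" is called a *conditional linear information inequality* if it holds for all joint distributions of $n$ variables. It is called *essentially conditional* if it is a conditional linear information inequality and, moreover, for all real $\lambda_1,\dots,\lambda_m$ there is a joint distribution for which the inequality $\alpha+\sum_{i=1}^m\lambda_i\beta_i\ge 0$ fails. **Theorem.** Each of the following eight implications, for the variables $(A,B,C,D)$ in (I1)–(I3), (I4′), (I5′) and $(A,B,C,D,E)$ in (I4)–(I6), is an essentially conditional linear information inequality: - (I1) if $I(A:B|C)=I(A:B)=0$, then $\square_{AB,CD}\ge 0$; - (I2) if $I(A:B|C)=I(B:D|C)=0$, then $\square_{AB,CD}\ge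 0$; - (I3) if $I(A:B|C)=H(C|A,B)=0$, then $\square_{AB,CD}\ge 0$; - (I4) if $I(A:D|C)=I(A:C|D)=0$, then $\square_{AB,CD}+I(A:C|E)+I(A:E|C)\ge 0$; - (I5) if $I(B:C|D)=I(C:D|B)=0$, then $\square_{AB,CD}+I(B:C|E)+I(C:E|B)\ge 0$; - (I6) if $I(B:C|D)=I(C:D|B)=0$, then $\square_{AB,CD}+I(C:D|E)+I(C:E|D)\ge 0$; - (I4′) if $I(A:D|C)=I(A:C|D)=0$, then $\square_{AB,CD}\ge 0$; - (I5′) if $I(B:C|D)=I(C:D|B)=0$, then $\square_{AB,CD}\ge 0$. -/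

import Mathlib

open scoped BigOperators

noncomputable section

/-- The joint distribution of `n` discrete random variables `X 0, …, X (n-1)` with finite ranges:
`Val i` is a finite set of values of the `i`-th variable, and `prob x` is the probability of the
event `X 0 = x 0, …, X (n-1) = x (n-1)`. -/
structure JointDist (n : ℕ) where
  /-- the values of the `i`-th variable -/
  Val : Fin n → Type
  /-- each variable has finitely many values -/
  fintypeVal : ∀ i, Fintype (Val i)
  /-- equality of values is decidable (no restriction, classically) -/
  decEqVal : ∀ i, DecidableEq (Val i)
  /-- the joint probability mass function -/
  prob : (∀ i, Val i) → ℝ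
  /-- the probabilities are nonnegative and sum up to one -/
  prob_mem : prob ∈ stdSimplex ℝ (∀ i, Val i)

attribute [instance] JointDist.fintypeVal JointDist.decEqVal

namespace JointDist

variable {n : ℕ}

/-- The marginal distribution of the subtuple `(X i)_{i ∈ S}`: the probability of the event
`X i = x i` for all `i ∈ S`. -/
def marginal (P : JointDist n) (S : Finset (Fin n)) (x : ∀ i : S, P.Val i) : ℝ :=
  ∑ y : (∀ i, P.Val i) with (∀ i : S, y i = x i), P.prob y

/-- The Shannon entropy, in bits, of the subtuple `(X i)_{i ∈ S}`. A value of probability zero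
contributes zero. -/
def entropy (P : JointDist n) (S : Finset (Fin n)) : ℝ :=
  ∑ x : (∀ i : S, P.Val i), P.marginal S x * Real.logb 2 (1 / P.marginal S x)

end JointDist

/-- A linear function on the entropies of `n` random variables, given by its `2 ^ n - 1` real
coefficients, one for each nonempty subtuple of the variables. -/
abbrev EntropyForm (n : ℕ) : Type := {S : Finset (Fin n) // S.Nonempty} → ℝ

namespace EntropyForm

variable {n : ℕ}

/-- The value of a linear function on entropies at a distribution. -/
def eval (κ : EntropyForm n) (P : JointDist n) : ℝ := ∑ S, κ S * P.entropy S.1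

/-- The form `H(S)`, the entropy of the subtuple `S` (zero for the empty subtuple). -/
def ent (S : Finset (Fin n)) : EntropyForm n := fun T => if T.1 = S then 1 else 0

/-- The conditional entropy `H(C | A, B) = H(A, B, C) - H(A, B)`. -/
def condEnt₂ (C A B : Fin n) : EntropyForm n := ent {A, B, C} - ent {A, B}

/-- The mutual information `I(A : B) = H(A) + H(B) - H(A, B)`. -/
def mutualInfo (A B : Fin n) : EntropyForm n := ent {A} + ent {B} - ent {A, B}

/-- The conditional mutual information
`I(A : B | C) = H(A, C) + H(B, C) - H(A, B, C) - H(C)`. -/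
def condMutualInfo (A B C : Fin n) : EntropyForm n :=
  ent {A, C} + ent {B, C} - ent {A, B, C} - ent {C}

/-- The Ingleton expression `□_{AB,CD} = I(C : D | A) + I(C : D | B) + I(A : B) - I(C : D)`. -/
def box (A B C D : Fin n) : EntropyForm n :=
  condMutualInfo C D A + condMutualInfo C D B + mutualInfo A B - mutualInfo C D

end EntropyForm

/-- The implication `(β i = 0 for all i) ⇒ α ≥ 0` is a conditional linear information inequality:
it holds for all distributions. -/
def IsConditionalInequality {n m : ℕ} (α : EntropyForm n) (β : Fin m → EntropyForm n) : Prop :=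
  ∀ P : JointDist n, (∀ i, (β i).eval P = 0) → 0 ≤ α.eval P

/-- The implication `(β i = 0 for all i) ⇒ α ≥ 0` is an essentially conditional linear information
inequality: it is a conditional linear information inequality, and for every choice of real
multipliers the inequality `α + ∑ i, c i * β i ≥ 0` fails for some distribution. -/
def IsEssentiallyConditional {n m : ℕ} (α : EntropyForm n) (β : Fin m → EntropyForm n) : Prop :=
  IsConditionalInequality α β ∧
    ∀ c : Fin m → ℝ, ∃ P : JointDist n, ¬ 0 ≤ α.eval P + ∑ i, c i * (β i).eval P

end

open EntropyForm

/-! Random variables are functions on a finite weighted space, and P denotes their law. Two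
mechanisms prove the implications, and three families of examples defeat all multipliers.

Suppose I(A:B|C) = 0. Let p be the law that keeps the laws of (A,C,D) and (B,C,D) and makes A and B
independent given (C,D), and let q(a,b,c,d) = P(c|a,b) P(a,d) P(b,d) / P(d), whose total weight is
at most 1. As P(a,b,c) = P(a,c) P(b,c) / P(c), log(q/p) is a function of (a,c,d) plus a function of
(b,c,d) minus log P(a,b). The first two have the same mean under p and under P. So □ is the relative
entropy of p to q, hence nonnegative, whenever log P(A,B) also has the same mean under both
(`ingleton_nonneg_of_condIndep`). This holds if A and B are independent (the logarithm splits), if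
I(B:D|C) = 0 (the law of (A,B) does not change), and if C is determined by (A,B) (then P(a,b) =
P(a,c) P(b,c) / P(c), which splits again).

A pair of constraints such as I(A:D|C) = I(A:C|D) = 0 is handled by the double Markov property:
almost surely the conditional law W of A given C equals that given D. So W is a function of C and
also of D, and H(A|C) = H(A|W). With W as an auxiliary variable, □ becomes a sum of nonnegative
Shannon quantities; the pair I(B:C|D) = I(C:D|B) = 0 is similar.

The constraint forms are nonnegative, so essential conditionality only needs, for each K ≥ 0, a
distribution with □ + K(β₁ + β₂) < 0. In the examples □ is negative of larger order than the
constraints: -e against e² (`rare_and_bounds`), y log y against y (`and_or_bounds`), -x² against x³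
(`crossing_bounds`). In five variables the two extra terms are nonnegative, and they vanish when E
copies a suitable variable. -/

section FiniteProbability

/-! ### Entropy on a finite weighted space, and Gibbs' inequality with its equality case. -/

variable {Ω α β γ δ : Type*} [Fintype Ω]

open Classical in
/-- The total weight of the event `E`. -/
noncomputable def mass (w : Ω → ℝ) (E : Ω → Prop) : ℝ := ∑ ω, if E ω then w ω else 0

/-- The Shannon entropy, in nats, of the random variable `f` on the finite space `Ω` with
weights `w`. -/
noncomputable def shannon (w : Ω → ℝ) (f : Ω → α) : ℝ :=
  -∑ ω, w ω * Real.log (mass w (fun ω' => f ω' = f ω))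

/-- The conditional mutual information, in nats, of `f` and `g` given `h`. -/
noncomputable def cmi (w : Ω → ℝ) (f : Ω → α) (g : Ω → β) (h : Ω → γ) : ℝ :=
  shannon w (fun ω => (f ω, h ω)) + shannon w (fun ω => (g ω, h ω))
    - shannon w (fun ω => (f ω, g ω, h ω)) - shannon w h

variable {w : Ω → ℝ}

theorem mass_congr {E F : Ω → Prop} (h : ∀ ω, E ω ↔ F ω) : mass w E = mass w F := by
  have : E = F := funext fun ω => propext (h ω)
  rw [this]

theorem mass_congr_of_pos (hw : ∀ ω, 0 ≤ w ω) {E F : Ω → Prop}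
    (h : ∀ ω, 0 < w ω → (E ω ↔ F ω)) : mass w E = mass w F := by
  unfold mass
  refine Finset.sum_congr rfl fun ω _ => ?_
  rcases (hw ω).eq_or_lt with h0 | h0
  · rw [← h0, ite_self, ite_self]
  · by_cases hF : F ω
    · rw [if_pos hF, if_pos ((h ω h0).2 hF)]
    · rw [if_neg hF, if_neg (hF ∘ (h ω h0).1)]

theorem mass_nonneg (hw : ∀ ω, 0 ≤ w ω) (E : Ω → Prop) : 0 ≤ mass w E :=
  Finset.sum_nonneg fun ω _ => by split_ifs <;> simp [hw]

theorem mass_mono (hw : ∀ ω, 0 ≤ w ω) {E F : Ω → Prop} (h : ∀ ω, E ω → F ω) :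
    mass w E ≤ mass w F :=
  Finset.sum_le_sum fun ω _ => by
    by_cases hE : E ω
    · simp [hE, h ω hE]
    · by_cases hF : F ω <;> simp [hE, hF, hw]

theorem le_mass (hw : ∀ ω, 0 ≤ w ω) {E : Ω → Prop} {ω : Ω} (h : E ω) : w ω ≤ mass w E := by
  classical
  have := Finset.single_le_sum (f := fun ω => if E ω then w ω else 0)
    (fun ω _ => by split_ifs <;> simp [hw]) (Finset.mem_univ ω)
  simpa [mass, h] using this

theorem mass_pos (hw : ∀ ω, 0 ≤ w ω) {E : Ω → Prop} {ω : Ω} (h : E ω) (hω : 0 < w ω) :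
    0 < mass w E := hω.trans_le (le_mass hw h)

theorem mass_eq_zero_of_imp (hw : ∀ ω, 0 ≤ w ω) {E F : Ω → Prop} (h : ∀ ω, E ω → F ω)
    (hF : mass w F = 0) : mass w E = 0 :=
  le_antisymm (hF ▸ mass_mono hw h) (mass_nonneg hw E)

theorem sum_mass_and [Fintype β] (w : Ω → ℝ) (E : Ω → Prop) (g : Ω → β) :
    ∑ b, mass w (fun ω => E ω ∧ g ω = b) = mass w E := by
  classical
  unfold mass
  rw [Finset.sum_comm]
  refine Finset.sum_congr rfl fun ω _ => ?_
  by_cases hE : E ω <;> simp [hE]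

theorem sum_mass_mul [Fintype α] (w : Ω → ℝ) (f : Ω → α) (G : α → ℝ) :
    ∑ a, mass w (fun ω => f ω = a) * G a = ∑ ω, w ω * G (f ω) := by
  classical
  unfold mass
  simp_rw [Finset.sum_mul]
  rw [Finset.sum_comm]
  refine Finset.sum_congr rfl fun ω _ => ?_
  simp

/-- Variables that separate the same points of positive weight have the same entropy. -/
theorem shannon_congr (hw : ∀ ω, 0 ≤ w ω) {f : Ω → α} {g : Ω → β}
    (h : ∀ ω ω', 0 < w ω → 0 < w ω' → (f ω' = f ω ↔ g ω' = g ω)) :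
    shannon w f = shannon w g := by
  unfold shannon
  congr 1
  refine Finset.sum_congr rfl fun ω _ => ?_
  rcases (hw ω).eq_or_lt with h0 | h0
  · simp [← h0]
  · rw [mass_congr_of_pos hw fun ω' h' => h ω ω' h0 h']

/-- One summand of Gibbs' inequality, from log x ≤ x - 1 at x = q / p. It also serves below as a
numerical tangent-line bound. -/
theorem mul_log_sub_le {p q : ℝ} (hp : 0 ≤ p) (hq : 0 ≤ q) (h : 0 < p → 0 < q) :
    p * (Real.log q - Real.log p) ≤ q - p := by
  rcases hp.eq_or_lt with h0 | h0
  · simp [← h0, hq]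
  · have hq' := h h0
    rw [← Real.log_div hq'.ne' h0.ne']
    have := Real.log_le_sub_one_of_pos (div_pos hq' h0)
    calc p * Real.log (q / p) ≤ p * (q / p - 1) := by gcongr
      _ = q - p := by field_simp

theorem eq_of_mul_log_sub_eq {p q : ℝ} (hp : 0 ≤ p) (h : 0 < p → 0 < q)
    (he : p * (Real.log q - Real.log p) = q - p) : p = q := by
  rcases hp.eq_or_lt with h0 | h0
  · rw [← h0] at he; linarith
  · have hq' := h h0
    by_contra hne
    rw [← Real.log_div hq'.ne' h0.ne'] at he
    have h1 : q / p ≠ 1 := fun h => hne (by rw [div_eq_one_iff_eq h0.ne'] at h; exact h.symm)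
    have := Real.log_lt_sub_one_of_pos (div_pos hq' h0) h1
    have h2 : p * Real.log (q / p) < p * (q / p - 1) := by gcongr
    have h3 : p * (q / p - 1) = q - p := by field_simp
    linarith

/-- Exhibits conditional mutual information as the relative entropy of the joint law to P(a,c)
P(b,c) / P(c). -/
theorem cmi_eq_sum [Fintype α] [Fintype β] [Fintype γ] (hw : ∀ ω, 0 ≤ w ω)
    (f : Ω → α) (g : Ω → β) (h : Ω → γ) :
    cmi w f g h = -∑ t : α × β × γ, mass w (fun ω => (f ω, g ω, h ω) = t) *
      (Real.log (mass w (fun ω => (f ω, h ω) = (t.1, t.2.2)) *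
        mass w (fun ω => (g ω, h ω) = t.2) / mass w (fun ω => h ω = t.2.2))
        - Real.log (mass w (fun ω => (f ω, g ω, h ω) = t))) := by
  rw [sum_mass_mul w (fun ω => (f ω, g ω, h ω)) (fun t =>
    Real.log (mass w (fun ω => (f ω, h ω) = (t.1, t.2.2)) *
        mass w (fun ω => (g ω, h ω) = t.2) / mass w (fun ω => h ω = t.2.2))
        - Real.log (mass w (fun ω => (f ω, g ω, h ω) = t)))]
  unfold cmi shannon
  have : ∀ a b c d : ℝ, -a + -b - -c - -d = -(a + b - c - d) := fun a b c d => by ring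
  rw [this, ← Finset.sum_add_distrib, ← Finset.sum_sub_distrib, ← Finset.sum_sub_distrib]
  congr 1
  refine Finset.sum_congr rfl fun ω _ => ?_
  rcases (hw ω).eq_or_lt with h0 | h0
  · simp [← h0]
  · have h1 : mass w (fun ω' => (f ω', h ω') = (f ω, h ω)) ≠ 0 := (mass_pos hw (ω := ω) (by rfl) h0).ne'
    have h2 : mass w (fun ω' => (g ω', h ω') = (g ω, h ω)) ≠ 0 := (mass_pos hw (ω := ω) (by rfl) h0).ne'
    have h3 : mass w (fun ω' => h ω' = h ω) ≠ 0 := (mass_pos hw (ω := ω) (by rfl) h0).ne'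
    dsimp only
    rw [Real.log_div (mul_ne_zero h1 h2) h3, Real.log_mul h1 h2]
    ring

theorem sum_mass (w : Ω → ℝ) [Fintype α] (f : Ω → α) :
    ∑ a, mass w (fun ω => f ω = a) = ∑ ω, w ω := by
  simpa using sum_mass_mul w f (fun _ => 1)

theorem sum_mass_fst [Fintype α] (w : Ω → ℝ) (f : Ω → α) (h : Ω → γ) (c : γ) :
    ∑ a, mass w (fun ω => (f ω, h ω) = (a, c)) = mass w (fun ω => h ω = c) := by
  rw [← sum_mass_and w (fun ω => h ω = c) f]
  exact Finset.sum_congr rfl fun a _ => mass_congr fun ω => by simp [and_comm]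

theorem sum_condIndep_le [Fintype α] [Fintype β] [Fintype γ] (w : Ω → ℝ)
    (f : Ω → α) (g : Ω → β) (h : Ω → γ) :
    ∑ t : α × β × γ, mass w (fun ω => (f ω, h ω) = (t.1, t.2.2)) *
        mass w (fun ω => (g ω, h ω) = t.2) / mass w (fun ω => h ω = t.2.2) ≤ ∑ ω, w ω := by
  rw [Fintype.sum_prod_type, Finset.sum_comm, Fintype.sum_prod_type, Finset.sum_comm,
    ← sum_mass w h]
  refine Finset.sum_le_sum fun c _ => ?_
  simp_rw [← Finset.sum_div, ← Finset.sum_mul]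
  rw [← Finset.mul_sum, sum_mass_fst, sum_mass_fst]
  -- Summing out a and b leaves P(c)² / P(c), which is 0 for P(c) = 0 by the convention on division
  -- by zero.
  rcases eq_or_ne (mass w fun ω => h ω = c) 0 with h0 | h0
  · simp [h0]
  · rw [mul_div_cancel_right₀ _ h0]

theorem condIndep_pos_of_pos (hw : ∀ ω, 0 ≤ w ω)
    (f : Ω → α) (g : Ω → β) (h : Ω → γ) (t : α × β × γ)
    (ht : 0 < mass w (fun ω => (f ω, g ω, h ω) = t)) :
    0 < mass w (fun ω => (f ω, h ω) = (t.1, t.2.2)) *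
        mass w (fun ω => (g ω, h ω) = t.2) / mass w (fun ω => h ω = t.2.2) := by
  refine div_pos (mul_pos ?_ ?_) ?_ <;>
  · refine ht.trans_le (mass_mono hw ?_)
    rintro ω rfl
    rfl

theorem cmi_nonneg_of_fintype [Fintype α] [Fintype β] [Fintype γ] (hw : ∀ ω, 0 ≤ w ω)
    (f : Ω → α) (g : Ω → β) (h : Ω → γ) : 0 ≤ cmi w f g h := by
  rw [cmi_eq_sum hw, neg_nonneg]
  refine (Finset.sum_le_sum fun t _ => mul_log_sub_le (mass_nonneg hw _)
    (div_nonneg (mul_nonneg (mass_nonneg hw _) (mass_nonneg hw _)) (mass_nonneg hw _))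
    (condIndep_pos_of_pos hw f g h t)).trans ?_
  rw [Finset.sum_sub_distrib, sum_mass, sub_nonpos]
  exact sum_condIndep_le w f g h

theorem cmi_congr {α' β' γ' : Type*} (hw : ∀ ω, 0 ≤ w ω) {f : Ω → α} {g : Ω → β} {h : Ω → γ}
    {f' : Ω → α'} {g' : Ω → β'} {h' : Ω → γ'}
    (hf : ∀ ω ω', 0 < w ω → 0 < w ω' → (f ω' = f ω ↔ f' ω' = f' ω))
    (hg : ∀ ω ω', 0 < w ω → 0 < w ω' → (g ω' = g ω ↔ g' ω' = g' ω))
    (hh : ∀ ω ω', 0 < w ω → 0 < w ω' → (h ω' = h ω ↔ h' ω' = h' ω)) :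
    cmi w f g h = cmi w f' g' h' := by
  unfold cmi
  congr 1
  · congr 1
    · congr 1 <;> refine shannon_congr hw fun ω ω' h1 h2 => ?_
      · simp [hf ω ω' h1 h2, hh ω ω' h1 h2]
      · simp [hg ω ω' h1 h2, hh ω ω' h1 h2]
    · refine shannon_congr hw fun ω ω' h1 h2 => ?_
      simp [hf ω ω' h1 h2, hg ω ω' h1 h2, hh ω ω' h1 h2]
  · exact shannon_congr hw hh

/-- Codomains must be arbitrary: later the variables include conditional laws, whose type `α → ℝ` is
infinite. Restricting to ranges reduces to the finite case. -/
theorem cmi_nonneg (hw : ∀ ω, 0 ≤ w ω) (f : Ω → α) (g : Ω → β) (h : Ω → γ) :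
    0 ≤ cmi w f g h := by
  classical
  have := cmi_nonneg_of_fintype hw (Set.rangeFactorization f) (Set.rangeFactorization g)
    (Set.rangeFactorization h)
  rwa [cmi_congr hw (f' := f) (g' := g) (h' := h)] at this <;>
  · intro ω ω' _ _
    simp [Set.rangeFactorization, Subtype.ext_iff]

/-- If the relative entropy vanishes, the summed Gibbs bound is an equality, hence so is each
summand, and strictness of log x < x - 1 forces the two laws to agree. -/
theorem mass_mul_mass_of_cmi_eq_zero [Fintype α] [Fintype β] [Fintype γ] (hw : ∀ ω, 0 ≤ w ω)
    {f : Ω → α} {g : Ω → β} {h : Ω → γ} (h0 : cmi w f g h = 0) (a : α) (b : β) (c : γ) :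
    mass w (fun ω => f ω = a ∧ g ω = b ∧ h ω = c) * mass w (fun ω => h ω = c) =
      mass w (fun ω => f ω = a ∧ h ω = c) * mass w (fun ω => g ω = b ∧ h ω = c) := by
  rw [cmi_eq_sum hw, neg_eq_zero] at h0
  have hle := fun t => mul_log_sub_le (mass_nonneg hw _)
    (div_nonneg (mul_nonneg (mass_nonneg hw _) (mass_nonneg hw _)) (mass_nonneg hw _))
    (condIndep_pos_of_pos hw f g h t)
  have hsum : ∑ t, (mass w (fun ω => (f ω, h ω) = (t.1, t.2.2)) *
        mass w (fun ω => (g ω, h ω) = t.2) / mass w (fun ω => h ω = t.2.2)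
        - mass w (fun ω => (f ω, g ω, h ω) = t)) ≤ 0 := by
    rw [Finset.sum_sub_distrib, sum_mass, sub_nonpos]
    exact sum_condIndep_le w f g h
  have hsum' := le_antisymm hsum (h0 ▸ Finset.sum_le_sum fun t _ => hle t)
  have heq := (Finset.sum_eq_sum_iff_of_le fun t _ => hle t).1 (h0.trans hsum'.symm)
    (a, b, c) (Finset.mem_univ _)
  have := eq_of_mul_log_sub_eq (mass_nonneg hw _) (condIndep_pos_of_pos hw f g h (a, b, c)) heq
  simp only [Prod.mk.injEq] at this
  rcases eq_or_ne (mass w fun ω => h ω = c) 0 with hc | hc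
  · rw [hc, mass_eq_zero_of_imp hw (fun ω (hω : f ω = a ∧ h ω = c) => hω.2) hc]
    ring
  · rw [this, div_mul_cancel₀ _ hc]

end FiniteProbability

/-! ### The double Markov property and the Ingleton inequality under two Markov constraints. -/

section Ingleton

variable {Ω α β γ δ : Type*} [Fintype Ω] {w : Ω → ℝ}

/-- The mutual information, in nats, of `f` and `g`. -/
noncomputable def mutInfo (w : Ω → ℝ) (f : Ω → α) (g : Ω → β) : ℝ :=
  shannon w f + shannon w g - shannon w (fun ω => (f ω, g ω))

/-- The Ingleton expression, in nats. -/
noncomputable def ingleton (w : Ω → ℝ) (A : Ω → α) (B : Ω → β) (C : Ω → γ) (D : Ω → δ) : ℝ :=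
  cmi w C D A + cmi w C D B + mutInfo w A B - mutInfo w C D

/-- A partition of the outcomes into equal conditional laws of `f` is a sufficient statistic. -/
theorem mass_and_comp_eq [Fintype γ] {f : Ω → α} {h : Ω → γ} {K : γ → α → ℝ}
    (hK : ∀ a c, mass w (fun ω => f ω = a ∧ h ω = c) = K c a * mass w (fun ω => h ω = c))
    (a : α) (v : α → ℝ) :
    mass w (fun ω => f ω = a ∧ K (h ω) = v) = v a * mass w (fun ω => K (h ω) = v) := by
  rw [← sum_mass_and w _ h, ← sum_mass_and w (fun ω => K (h ω) = v) h, Finset.mul_sum]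
  refine Finset.sum_congr rfl fun c _ => ?_
  by_cases hc : K c = v
  · rw [mass_congr (F := fun ω => f ω = a ∧ h ω = c), hK, hc,
      mass_congr (E := fun ω => K (h ω) = v ∧ h ω = c) (F := fun ω => h ω = c)]
    · exact fun ω => ⟨fun hω => hω.2, fun hω => ⟨by rw [hω, hc], hω⟩⟩
    · exact fun ω => ⟨fun hω => ⟨hω.1.1, hω.2⟩, fun hω => ⟨⟨hω.1, by rw [hω.2, hc]⟩, hω.2⟩⟩
  · rw [mass_congr (F := fun _ => False),
      mass_congr (E := fun ω => K (h ω) = v ∧ h ω = c) (F := fun _ => False)]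
    · simp [mass]
    · rintro ω
      rw [iff_false]
      rintro ⟨h1, rfl⟩
      exact hc h1
    · rintro ω
      rw [iff_false]
      rintro ⟨⟨_, h1⟩, rfl⟩
      exact hc h1

/-- H(f|h) = H(f|K(h)): both are means of -log K, because merging the values of h with equal
conditional laws keeps the conditional probability. -/
theorem shannon_sub_eq_of_law [Fintype γ] (hw : ∀ ω, 0 ≤ w ω) {f : Ω → α} {h : Ω → γ}
    {K : γ → α → ℝ}
    (hK : ∀ a c, mass w (fun ω => f ω = a ∧ h ω = c) = K c a * mass w (fun ω => h ω = c)) :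
    shannon w (fun ω => (f ω, h ω)) - shannon w h =
      shannon w (fun ω => (f ω, K (h ω))) - shannon w (fun ω => K (h ω)) := by
  unfold shannon
  rw [neg_sub_neg, neg_sub_neg, ← Finset.sum_sub_distrib, ← Finset.sum_sub_distrib]
  refine Finset.sum_congr rfl fun ω _ => ?_
  rcases (hw ω).eq_or_lt with h0 | h0
  · simp [← h0]
  have h1 : 0 < mass w fun ω' => h ω' = h ω := mass_pos hw (ω := ω) rfl h0
  have h2 : 0 < mass w fun ω' => K (h ω') = K (h ω) := mass_pos hw (ω := ω) rfl h0
  have h3 : 0 < mass w fun ω' => f ω' = f ω ∧ h ω' = h ω := mass_pos hw (ω := ω) ⟨rfl, rfl⟩ h0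
  have h4 : K (h ω) (f ω) ≠ 0 := by
    rw [hK] at h3
    exact (pos_of_mul_pos_left h3 h1.le).ne'
  simp only [Prod.mk.injEq]
  rw [hK, mass_and_comp_eq hK, Real.log_mul h4 h1.ne', Real.log_mul h4 h2.ne']
  ring

/-- The conditional law of `f` given the value `c` of `h`. -/
noncomputable def law (w : Ω → ℝ) (f : Ω → α) (h : Ω → γ) (c : γ) (a : α) : ℝ :=
  mass w (fun ω => f ω = a ∧ h ω = c) / mass w (fun ω => h ω = c)

theorem mass_eq_law_mul (hw : ∀ ω, 0 ≤ w ω) (f : Ω → α) (h : Ω → γ) (a : α) (c : γ) :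
    mass w (fun ω => f ω = a ∧ h ω = c) = law w f h c a * mass w (fun ω => h ω = c) := by
  rcases eq_or_ne (mass w fun ω => h ω = c) 0 with hc | hc
  · rw [hc, mass_eq_zero_of_imp hw (fun ω (hω : f ω = a ∧ h ω = c) => hω.2) hc, mul_zero]
  · rw [law, div_mul_cancel₀ _ hc]

/-- Double Markov property: if `f` is independent of `g` given `h`, and of `h` given `g`, then
the conditional laws of `f` given `h` and given `g` agree almost surely. -/
theorem law_eq_law_of_cmi_eq_zero [Fintype α] [Fintype β] [Fintype γ] (hw : ∀ ω, 0 ≤ w ω)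
    {f : Ω → α} {g : Ω → β} {h : Ω → γ} (h1 : cmi w f g h = 0) (h2 : cmi w f h g = 0)
    {ω : Ω} (hω : 0 < w ω) : law w f h (h ω) = law w f g (g ω) := by
  funext a
  have e1 := mass_mul_mass_of_cmi_eq_zero hw h1 a (g ω) (h ω)
  have e2 := mass_mul_mass_of_cmi_eq_zero hw h2 a (h ω) (g ω)
  rw [mass_congr (F := fun ω' => f ω' = a ∧ g ω' = g ω ∧ h ω' = h ω) (fun _ => by tauto),
    mass_congr (E := fun ω' => h ω' = h ω ∧ g ω' = g ω)
      (F := fun ω' => g ω' = g ω ∧ h ω' = h ω) (fun _ => by tauto)] at e2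
  have p1 : 0 < mass w fun ω' => h ω' = h ω := mass_pos hw (ω := ω) rfl hω
  have p2 : 0 < mass w fun ω' => g ω' = g ω := mass_pos hw (ω := ω) rfl hω
  have p3 : 0 < mass w fun ω' => g ω' = g ω ∧ h ω' = h ω :=
    mass_pos hw (ω := ω) ⟨rfl, rfl⟩ hω
  unfold law
  rw [div_eq_div_iff p1.ne' p2.ne']
  -- After multiplication by P(g,h) > 0 both sides equal P(a,g,h) P(g) P(h).
  apply mul_right_cancel₀ p3.ne'
  linear_combination (mass w fun ω' => h ω' = h ω) * e2 - (mass w fun ω' => g ω' = g ω) * e1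

theorem shannon_le_of_determines (hw : ∀ ω, 0 ≤ w ω) {f : Ω → α} {g : Ω → β}
    (h : ∀ ω ω', g ω' = g ω → f ω' = f ω) : shannon w f ≤ shannon w g := by
  refine neg_le_neg (Finset.sum_le_sum fun ω _ => ?_)
  rcases (hw ω).eq_or_lt with h0 | h0
  · simp [← h0]
  · have : 0 < mass w fun ω' => g ω' = g ω := mass_pos hw (ω := ω) rfl h0
    gcongr
    exact mass_mono hw fun ω' => h ω ω'

/-- With W the common conditional law of A given C and given D, □ = I(C:D|B,W) + I(A:B|W) +
H(W|A,B). The identity uses that W is determined by C and by D, and that H(A|C) = H(A|W). -/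
theorem ingleton_nonneg_of_markov_left [Fintype α] [Fintype γ] [Fintype δ] (hw : ∀ ω, 0 ≤ w ω)
    (A : Ω → α) (B : Ω → β) (C : Ω → γ) (D : Ω → δ)
    (h1 : cmi w A D C = 0) (h2 : cmi w A C D = 0) : 0 ≤ ingleton w A B C D := by
  have hlaw : ∀ ω, 0 < w ω → law w A C (C ω) = law w A D (D ω) := fun ω hω =>
    law_eq_law_of_cmi_eq_zero hw h1 h2 hω
  have hsuff := shannon_sub_eq_of_law hw (mass_eq_law_mul hw A C)
  set W : Ω → α → ℝ := fun ω => law w A C (C ω) with hW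
  have hD : ∀ ω ω', 0 < w ω → 0 < w ω' → D ω' = D ω → W ω' = W ω := by
    intro ω ω' p p' h
    simp only [hW, hlaw ω p, hlaw ω' p', h]
  have hC : ∀ ω ω', C ω' = C ω → W ω' = W ω := by
    intro ω ω' h
    simp only [hW, h]
  have s1 := cmi_nonneg hw C D (fun ω => (B ω, W ω))
  have s2 := cmi_nonneg hw A B W
  have s3 := shannon_le_of_determines hw (f := fun ω => (A ω, B ω))
    (g := fun ω => (A ω, B ω, W ω)) (by simp +contextual)
  have e1 : shannon w (fun ω => (C ω, B ω, W ω)) = shannon w (fun ω => (C ω, B ω)) :=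
    shannon_congr hw fun ω ω' _ _ => by have := hC ω ω'; simp only [Prod.mk.injEq]; tauto
  have e2 : shannon w (fun ω => (D ω, B ω, W ω)) = shannon w (fun ω => (D ω, B ω)) :=
    shannon_congr hw fun ω ω' p p' => by
      have := hD ω ω' p p'; simp only [Prod.mk.injEq]; tauto
  have e3 : shannon w (fun ω => (C ω, D ω, B ω, W ω)) = shannon w (fun ω => (C ω, D ω, B ω)) :=
    shannon_congr hw fun ω ω' _ _ => by have := hC ω ω'; simp only [Prod.mk.injEq]; tauto
  have e4 : shannon w (fun ω => (C ω, A ω)) = shannon w (fun ω => (A ω, C ω)) :=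
    shannon_congr hw fun ω ω' _ _ => by simp only [Prod.mk.injEq]; tauto
  have e5 : shannon w (fun ω => (D ω, A ω)) = shannon w (fun ω => (A ω, D ω)) :=
    shannon_congr hw fun ω ω' _ _ => by simp only [Prod.mk.injEq]; tauto
  have e6 : shannon w (fun ω => (C ω, D ω, A ω)) = shannon w (fun ω => (A ω, C ω, D ω)) :=
    shannon_congr hw fun ω ω' _ _ => by simp only [Prod.mk.injEq]; tauto
  simp only [cmi, ingleton, mutInfo] at *
  linarith

/-- With W the common conditional law of C given D and given B, □ = I(C:D|A,W) + I(A:B|W) +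
I(A:W|C). Here W is determined by B and by D, and H(C|D) = H(C|W). -/
theorem ingleton_nonneg_of_markov_right [Fintype β] [Fintype γ] [Fintype δ]
    (hw : ∀ ω, 0 ≤ w ω) (A : Ω → α) (B : Ω → β) (C : Ω → γ) (D : Ω → δ)
    (h1 : cmi w B C D = 0) (h2 : cmi w C D B = 0) : 0 ≤ ingleton w A B C D := by
  have h1' : cmi w C B D = 0 := by
    rw [← h1, cmi, cmi, shannon_congr hw (f := fun ω => (C ω, B ω, D ω))
      (g := fun ω => (B ω, C ω, D ω))]
    · ring
    · intro ω ω' _ _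
      simp only [Prod.mk.injEq]
      tauto
  have hlaw : ∀ ω, 0 < w ω → law w C D (D ω) = law w C B (B ω) := fun ω hω =>
    law_eq_law_of_cmi_eq_zero hw h1' h2 hω
  have hsuff := shannon_sub_eq_of_law hw (mass_eq_law_mul hw C D)
  set W : Ω → γ → ℝ := fun ω => law w C D (D ω) with hW
  have hB : ∀ ω ω', 0 < w ω → 0 < w ω' → B ω' = B ω → W ω' = W ω := by
    intro ω ω' p p' h
    simp only [hW, hlaw ω p, hlaw ω' p', h]
  have hD : ∀ ω ω', D ω' = D ω → W ω' = W ω := by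
    intro ω ω' h
    simp only [hW, h]
  have s1 := cmi_nonneg hw C D (fun ω => (A ω, W ω))
  have s2 := cmi_nonneg hw A B W
  have s3 := cmi_nonneg hw A W C
  have e1 : shannon w (fun ω => (D ω, A ω, W ω)) = shannon w (fun ω => (D ω, A ω)) :=
    shannon_congr hw fun ω ω' _ _ => by have := hD ω ω'; simp only [Prod.mk.injEq]; tauto
  have e2 : shannon w (fun ω => (C ω, D ω, A ω, W ω)) = shannon w (fun ω => (C ω, D ω, A ω)) :=
    shannon_congr hw fun ω ω' _ _ => by have := hD ω ω'; simp only [Prod.mk.injEq]; tauto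
  have e3 : shannon w (fun ω => (B ω, W ω)) = shannon w B :=
    shannon_congr hw fun ω ω' p p' => by
      have := hB ω ω' p p'; simp only [Prod.mk.injEq]; tauto
  have e4 : shannon w (fun ω => (A ω, B ω, W ω)) = shannon w (fun ω => (A ω, B ω)) :=
    shannon_congr hw fun ω ω' p p' => by
      have := hB ω ω' p p'; simp only [Prod.mk.injEq]; tauto
  have e5 : shannon w (fun ω => (A ω, W ω, C ω)) = shannon w (fun ω => (C ω, A ω, W ω)) :=
    shannon_congr hw fun ω ω' _ _ => by simp only [Prod.mk.injEq]; tauto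
  have e6 : shannon w (fun ω => (W ω, C ω)) = shannon w (fun ω => (C ω, W ω)) :=
    shannon_congr hw fun ω ω' _ _ => by simp only [Prod.mk.injEq]; tauto
  have e7 : shannon w (fun ω => (C ω, A ω)) = shannon w (fun ω => (A ω, C ω)) :=
    shannon_congr hw fun ω ω' _ _ => by simp only [Prod.mk.injEq]; tauto
  simp only [cmi, ingleton, mutInfo] at *
  linarith

end Ingleton

/-! ### Making A and B independent given (C,D). -/

section ConditionalProduct

variable {Ω α β γ δ τ : Type*} [Fintype Ω] {w : Ω → ℝ}

/-- The weights of the triples of values for which the pairs `(A, T)` and `(B, T)` keep their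
laws, and `A` and `B` are independent given `T`. -/
noncomputable def condProd (w : Ω → ℝ) (A : Ω → α) (B : Ω → β) (T : Ω → τ) (a : α) (b : β)
    (t : τ) : ℝ :=
  mass w (fun ω => A ω = a ∧ T ω = t) * mass w (fun ω => B ω = b ∧ T ω = t) /
    mass w (fun ω => T ω = t)

theorem condProd_nonneg (hw : ∀ ω, 0 ≤ w ω) (A : Ω → α) (B : Ω → β) (T : Ω → τ) (a : α) (b : β)
    (t : τ) : 0 ≤ condProd w A B T a b t :=
  div_nonneg (mul_nonneg (mass_nonneg hw _) (mass_nonneg hw _)) (mass_nonneg hw _)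

theorem condProd_comm (w : Ω → ℝ) (A : Ω → α) (B : Ω → β) (T : Ω → τ) (a : α) (b : β)
    (t : τ) : condProd w A B T a b t = condProd w B A T b a t := by
  unfold condProd
  rw [mul_comm]

theorem sum_mass_eq_and [Fintype β] (w : Ω → ℝ) (E : Ω → Prop) (g : Ω → β) :
    ∑ b, mass w (fun ω => g ω = b ∧ E ω) = mass w E := by
  rw [← sum_mass_and w E g]
  exact Finset.sum_congr rfl fun b _ => mass_congr fun ω => and_comm

theorem sum_condProd_right [Fintype β] (hw : ∀ ω, 0 ≤ w ω) (A : Ω → α) (B : Ω → β) (T : Ω → τ)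
    (a : α) (t : τ) : ∑ b, condProd w A B T a b t = mass w (fun ω => A ω = a ∧ T ω = t) := by
  unfold condProd
  rw [← Finset.sum_div, ← Finset.mul_sum, sum_mass_eq_and]
  rcases eq_or_ne (mass w fun ω => T ω = t) 0 with h0 | h0
  · rw [h0, div_zero, mass_eq_zero_of_imp hw (fun ω (hω : A ω = a ∧ T ω = t) => hω.2) h0]
  · rw [mul_div_cancel_right₀ _ h0]

theorem sum_mul_eq_sum_mass [Fintype α] [Fintype τ] (w : Ω → ℝ) (A : Ω → α) (T : Ω → τ)
    (G : α → τ → ℝ) :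
    ∑ ω, w ω * G (A ω) (T ω) = ∑ a, ∑ t, mass w (fun ω => A ω = a ∧ T ω = t) * G a t := by
  rw [← sum_mass_mul w (fun ω => (A ω, T ω)) (fun x => G x.1 x.2), Fintype.sum_prod_type]
  simp only [Prod.mk.injEq]

theorem sum_condProd_mul_left [Fintype α] [Fintype β] [Fintype τ] (hw : ∀ ω, 0 ≤ w ω)
    (A : Ω → α) (B : Ω → β) (T : Ω → τ) (G : α → τ → ℝ) :
    ∑ a, ∑ b, ∑ t, condProd w A B T a b t * G a t = ∑ ω, w ω * G (A ω) (T ω) := by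
  rw [sum_mul_eq_sum_mass]
  refine Finset.sum_congr rfl fun a _ => ?_
  rw [Finset.sum_comm]
  refine Finset.sum_congr rfl fun t _ => ?_
  rw [← Finset.sum_mul, sum_condProd_right hw]

theorem sum_condProd_mul_right [Fintype α] [Fintype β] [Fintype τ] (hw : ∀ ω, 0 ≤ w ω)
    (A : Ω → α) (B : Ω → β) (T : Ω → τ) (G : β → τ → ℝ) :
    ∑ a, ∑ b, ∑ t, condProd w A B T a b t * G b t = ∑ ω, w ω * G (B ω) (T ω) := by
  rw [Finset.sum_comm, ← sum_condProd_mul_left hw B A T G]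
  simp only [condProd_comm w A B]

theorem pos_of_condProd_pos (hw : ∀ ω, 0 ≤ w ω) {A : Ω → α} {B : Ω → β} {T : Ω → τ} {a : α}
    {b : β} {t : τ} (h : 0 < condProd w A B T a b t) :
    0 < mass w (fun ω => A ω = a ∧ T ω = t) ∧ 0 < mass w (fun ω => B ω = b ∧ T ω = t) ∧
      0 < mass w (fun ω => T ω = t) := by
  refine ⟨(mass_nonneg hw _).lt_of_ne fun h0 => ?_, (mass_nonneg hw _).lt_of_ne fun h0 => ?_,
    (mass_nonneg hw _).lt_of_ne fun h0 => ?_⟩ <;>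
  · rw [condProd, ← h0] at h
    simp at h

theorem sum_condProd [Fintype α] [Fintype β] [Fintype τ] (hw : ∀ ω, 0 ≤ w ω)
    (A : Ω → α) (B : Ω → β) (T : Ω → τ) :
    ∑ a, ∑ b, ∑ t, condProd w A B T a b t = ∑ ω, w ω := by
  simpa using sum_condProd_mul_left hw A B T fun _ _ => 1

/-- For fixed (a,b) the ratios P(a,b,c) / P(a,b) add up to at most 1 over c; they are all 0 when
P(a,b) = 0. -/
theorem sum_tilted_le [Fintype α] [Fintype β] [Fintype γ] [Fintype δ] (hw : ∀ ω, 0 ≤ w ω)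
    (A : Ω → α) (B : Ω → β) (C : Ω → γ) (D : Ω → δ) :
    ∑ a, ∑ b, ∑ t : γ × δ, mass w (fun ω => A ω = a ∧ B ω = b ∧ C ω = t.1) /
      mass w (fun ω => A ω = a ∧ B ω = b) * condProd w A B D a b t.2 ≤ ∑ ω, w ω := by
  rw [← sum_condProd hw A B D]
  refine Finset.sum_le_sum fun a _ => Finset.sum_le_sum fun b _ => ?_
  rw [Fintype.sum_prod_type_right]
  refine Finset.sum_le_sum fun d _ => ?_
  dsimp only
  rw [← Finset.sum_mul, ← Finset.sum_div]
  refine mul_le_of_le_one_left (condProd_nonneg hw A B D a b d) (div_le_one_of_le₀ ?_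
    (mass_nonneg hw _))
  rw [← sum_mass_and w (fun ω => A ω = a ∧ B ω = b) C]
  exact Finset.sum_le_sum fun c _ => mass_mono hw fun ω => by tauto

theorem ingleton_eq (hw : ∀ ω, 0 ≤ w ω) (A : Ω → α) (B : Ω → β) (C : Ω → γ) (D : Ω → δ) :
    ingleton w A B C D = shannon w (fun ω => (A ω, C ω)) + shannon w (fun ω => (A ω, D ω))
      - shannon w (fun ω => (A ω, C ω, D ω)) + shannon w (fun ω => (B ω, C ω))
      + shannon w (fun ω => (B ω, D ω)) - shannon w (fun ω => (B ω, C ω, D ω))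
      + shannon w (fun ω => (C ω, D ω)) - shannon w (fun ω => (A ω, B ω))
      - shannon w C - shannon w D := by
  have e1 : shannon w (fun ω => (C ω, A ω)) = shannon w (fun ω => (A ω, C ω)) :=
    shannon_congr hw fun ω ω' _ _ => by simp only [Prod.mk.injEq]; tauto
  have e2 : shannon w (fun ω => (D ω, A ω)) = shannon w (fun ω => (A ω, D ω)) :=
    shannon_congr hw fun ω ω' _ _ => by simp only [Prod.mk.injEq]; tauto
  have e3 : shannon w (fun ω => (C ω, B ω)) = shannon w (fun ω => (B ω, C ω)) :=
    shannon_congr hw fun ω ω' _ _ => by simp only [Prod.mk.injEq]; tauto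
  have e4 : shannon w (fun ω => (D ω, B ω)) = shannon w (fun ω => (B ω, D ω)) :=
    shannon_congr hw fun ω ω' _ _ => by simp only [Prod.mk.injEq]; tauto
  have e5 : shannon w (fun ω => (C ω, D ω, A ω)) = shannon w (fun ω => (A ω, C ω, D ω)) :=
    shannon_congr hw fun ω ω' _ _ => by simp only [Prod.mk.injEq]; tauto
  have e6 : shannon w (fun ω => (C ω, D ω, B ω)) = shannon w (fun ω => (B ω, C ω, D ω)) :=
    shannon_congr hw fun ω ω' _ _ => by simp only [Prod.mk.injEq]; tauto
  simp only [ingleton, cmi, mutInfo]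
  linarith

/-- The Ingleton inequality holds if `A` and `B` are independent given `C` and the expected
logarithm of the weight of `(A, B)` does not change when `A` and `B` are made independent given
`(C, D)`. -/
theorem ingleton_nonneg_of_condIndep [Fintype α] [Fintype β] [Fintype γ] [Fintype δ]
    (hw : ∀ ω, 0 ≤ w ω) (A : Ω → α) (B : Ω → β) (C : Ω → γ) (D : Ω → δ)
    (hcmi : cmi w A B C = 0)
    (hAB : ∑ ω, w ω * Real.log (mass w fun ω' => A ω' = A ω ∧ B ω' = B ω) =
      ∑ a, ∑ b, ∑ t, condProd w A B (fun ω => (C ω, D ω)) a b t *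
        Real.log (mass w fun ω => A ω = a ∧ B ω = b)) :
    0 ≤ ingleton w A B C D := by
  let T : Ω → γ × δ := fun ω => (C ω, D ω)
  let p : α → β → γ × δ → ℝ := condProd w A B T
  -- On the support of `p`, log(`q` / `p`) = `G₁` + `G₂` - `G`. Only `G` couples a with b, and `hAB`
  -- controls its mean.
  let G₁ : α → γ × δ → ℝ := fun a t =>
    Real.log (mass w fun ω => A ω = a ∧ C ω = t.1) + Real.log (mass w fun ω => A ω = a ∧ D ω = t.2)
      - Real.log (mass w fun ω => A ω = a ∧ T ω = t) - Real.log (mass w fun ω => C ω = t.1)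
  let G₂ : β → γ × δ → ℝ := fun b t =>
    Real.log (mass w fun ω => B ω = b ∧ C ω = t.1) + Real.log (mass w fun ω => B ω = b ∧ D ω = t.2)
      - Real.log (mass w fun ω => B ω = b ∧ T ω = t) - Real.log (mass w fun ω => D ω = t.2)
      + Real.log (mass w fun ω => T ω = t)
  let G : α → β → ℝ := fun a b => Real.log (mass w fun ω => A ω = a ∧ B ω = b)
  let q : α → β → γ × δ → ℝ := fun a b t => mass w (fun ω => A ω = a ∧ B ω = b ∧ C ω = t.1) /
      mass w (fun ω => A ω = a ∧ B ω = b) * condProd w A B D a b t.2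
  have key : ingleton w A B C D =
      -∑ a, ∑ b, ∑ t, p a b t * (G₁ a t + G₂ b t - G a b) := by
    have : ∑ a, ∑ b, ∑ t, p a b t * (G₁ a t + G₂ b t - G a b) =
        ∑ ω, w ω * G₁ (A ω) (T ω) + ∑ ω, w ω * G₂ (B ω) (T ω) - ∑ ω, w ω * G (A ω) (B ω) := by
      rw [← sum_condProd_mul_left hw A B T G₁, ← sum_condProd_mul_right hw A B T G₂]
      change _ = _ - ∑ ω, w ω * Real.log (mass w fun ω' => A ω' = A ω ∧ B ω' = B ω)
      rw [hAB]
      simp only [← Finset.sum_add_distrib, ← Finset.sum_sub_distrib, ← mul_add, ← mul_sub, p, G, T]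
    rw [this, ← Finset.sum_add_distrib, ← Finset.sum_sub_distrib, ingleton_eq hw]
    simp only [shannon, Prod.mk.injEq, sub_neg_eq_add, ← sub_eq_add_neg, G₁, G₂, G, T]
    simp only [← Finset.sum_add_distrib, ← Finset.sum_sub_distrib,
      ← Finset.sum_neg_distrib]
    exact Finset.sum_congr rfl fun ω _ => by ring
  have hterm : ∀ a b t, p a b t * (G₁ a t + G₂ b t - G a b) ≤ q a b t - p a b t := by
    intro a b t
    have hp : 0 ≤ p a b t := condProd_nonneg hw A B T a b t
    have hq : 0 ≤ q a b t := mul_nonneg (div_nonneg (mass_nonneg hw _) (mass_nonneg hw _))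
      (condProd_nonneg hw A B D a b t.2)
    rcases hp.eq_or_lt with h0 | h0
    · rw [← h0]; simpa using hq
    obtain ⟨h1, h2, h3⟩ := pos_of_condProd_pos hw h0
    have pos : ∀ {E F : Ω → Prop}, 0 < mass w E → (∀ ω, E ω → F ω) → 0 < mass w F :=
      fun h h' => h.trans_le (mass_mono hw h')
    have hac : 0 < mass w fun ω => A ω = a ∧ C ω = t.1 := pos h1 fun ω h => ⟨h.1, by rw [← h.2]⟩
    have had : 0 < mass w fun ω => A ω = a ∧ D ω = t.2 := pos h1 fun ω h => ⟨h.1, by rw [← h.2]⟩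
    have hbc : 0 < mass w fun ω => B ω = b ∧ C ω = t.1 := pos h2 fun ω h => ⟨h.1, by rw [← h.2]⟩
    have hbd : 0 < mass w fun ω => B ω = b ∧ D ω = t.2 := pos h2 fun ω h => ⟨h.1, by rw [← h.2]⟩
    have hc : 0 < mass w fun ω => C ω = t.1 := pos hac fun ω h => h.2
    have hd : 0 < mass w fun ω => D ω = t.2 := pos had fun ω h => h.2
    -- Independence given C makes P(a,b,c) positive on the support of `p`, even where the original
    -- law gives (a,b,c,d) weight zero, and splits its logarithm.
    have hind := mass_mul_mass_of_cmi_eq_zero hw hcmi a b t.1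
    have habc : 0 < mass w fun ω => A ω = a ∧ B ω = b ∧ C ω = t.1 :=
      pos_of_mul_pos_left (hind ▸ mul_pos hac hbc) hc.le
    have hab : 0 < mass w fun ω => A ω = a ∧ B ω = b := pos habc fun ω h => ⟨h.1, h.2.1⟩
    have hlog := congrArg Real.log hind
    rw [Real.log_mul habc.ne' hc.ne', Real.log_mul hac.ne' hbc.ne'] at hlog
    have hqpos : 0 < q a b t := mul_pos (div_pos habc hab) (div_pos (mul_pos had hbd) hd)
    have := mul_log_sub_le h0.le hq fun _ => hqpos
    refine le_trans (le_of_eq ?_) this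
    congr 1
    simp only [p, q, condProd, G₁, G₂, G]
    rw [Real.log_mul (div_pos habc hab).ne' (div_pos (mul_pos had hbd) hd).ne',
      Real.log_div habc.ne' hab.ne', Real.log_div (mul_pos had hbd).ne' hd.ne',
      Real.log_mul had.ne' hbd.ne', Real.log_div (mul_pos h1 h2).ne' h3.ne',
      Real.log_mul h1.ne' h2.ne']
    linarith
  rw [key, neg_nonneg]
  refine (Finset.sum_le_sum fun a _ => Finset.sum_le_sum fun b _ => Finset.sum_le_sum
    fun t _ => hterm a b t).trans ?_
  simp only [Finset.sum_sub_distrib]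
  rw [sum_condProd hw A B T, sub_nonpos]
  exact sum_tilted_le hw A B C D

theorem sum_mul_congr_of_pos (hw : ∀ ω, 0 ≤ w ω) {F G : Ω → ℝ} (h : ∀ ω, 0 < w ω → F ω = G ω) :
    ∑ ω, w ω * F ω = ∑ ω, w ω * G ω := by
  refine Finset.sum_congr rfl fun ω _ => ?_
  rcases (hw ω).eq_or_lt with h0 | h0
  · simp [← h0]
  · rw [h ω h0]

/-- A function of `(A, B)` that splits into functions of `(A, C, D)` and `(B, C, D)` has the same
mean when `A` and `B` are made independent given `(C, D)`. -/
theorem sum_mul_eq_sum_condProd_of_split [Fintype α] [Fintype β] [Fintype τ]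
    (hw : ∀ ω, 0 ≤ w ω) (A : Ω → α) (B : Ω → β) (T : Ω → τ) (G : α → β → ℝ)
    (G₁ : α → τ → ℝ) (G₂ : β → τ → ℝ)
    (h : ∀ a b t, 0 < condProd w A B T a b t → G a b = G₁ a t + G₂ b t)
    (h' : ∀ ω, 0 < w ω → G (A ω) (B ω) = G₁ (A ω) (T ω) + G₂ (B ω) (T ω)) :
    ∑ ω, w ω * G (A ω) (B ω) = ∑ a, ∑ b, ∑ t, condProd w A B T a b t * G a b := by
  have : ∀ a b t, condProd w A B T a b t * G a b =
      condProd w A B T a b t * G₁ a t + condProd w A B T a b t * G₂ b t := by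
    intro a b t
    rcases (condProd_nonneg hw A B T a b t).eq_or_lt with h0 | h0
    · simp [← h0]
    · rw [h a b t h0, mul_add]
  simp only [this, Finset.sum_add_distrib]
  rw [sum_condProd_mul_left hw A B T G₁, sum_condProd_mul_right hw A B T G₂,
    ← Finset.sum_add_distrib, sum_mul_congr_of_pos hw h']
  exact Finset.sum_congr rfl fun ω _ => mul_add _ _ _

end ConditionalProduct

/-! ### Three conditions under which the mean of log P(A,B) is preserved. -/

section IngletonConditions

variable {Ω α β γ δ : Type*} [Fintype Ω] {w : Ω → ℝ}
  [Fintype α] [Fintype β] [Fintype γ] [Fintype δ]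

theorem exists_pos_of_mass_pos (hw : ∀ ω, 0 ≤ w ω) {E : Ω → Prop} (h : 0 < mass w E) :
    ∃ ω, 0 < w ω ∧ E ω := by
  by_contra! hne
  have : mass w E = 0 := by
    rw [mass_congr_of_pos hw (F := fun _ => False) fun ω hω => iff_false_intro (hne ω hω)]
    simp [mass]
  exact h.ne' this

theorem condIndep_pos {δ : Type*} (hw : ∀ ω, 0 ≤ w ω) {A : Ω → α} {B : Ω → β} {C : Ω → γ} {D : Ω → δ}
    (h : cmi w A B C = 0) {a : α} {b : β} {t : γ × δ}
    (ht : 0 < condProd w A B (fun ω => (C ω, D ω)) a b t) :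
    0 < mass w (fun ω => A ω = a ∧ B ω = b ∧ C ω = t.1) := by
  obtain ⟨h1, h2, h3⟩ := pos_of_condProd_pos hw ht
  have pos : ∀ {E F : Ω → Prop}, 0 < mass w E → (∀ ω, E ω → F ω) → 0 < mass w F :=
    fun h h' => h.trans_le (mass_mono hw h')
  have hac : 0 < mass w fun ω => A ω = a ∧ C ω = t.1 := pos h1 fun ω h => ⟨h.1, by rw [← h.2]⟩
  have hbc : 0 < mass w fun ω => B ω = b ∧ C ω = t.1 := pos h2 fun ω h => ⟨h.1, by rw [← h.2]⟩
  have hc : 0 < mass w fun ω => C ω = t.1 := pos hac fun ω h => h.2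
  exact pos_of_mul_pos_left (mass_mul_mass_of_cmi_eq_zero hw h a b t.1 ▸ mul_pos hac hbc) hc.le

theorem mass_eq_mul_of_mutInfo_eq_zero (hw : ∀ ω, 0 ≤ w ω) (hw1 : ∑ ω, w ω = 1)
    {A : Ω → α} {B : Ω → β} (h : mutInfo w A B = 0) (a : α) (b : β) :
    mass w (fun ω => A ω = a ∧ B ω = b) =
      mass w (fun ω => A ω = a) * mass w (fun ω => B ω = b) := by
  have h1 : mass w (fun _ => True) = 1 := by simpa [mass] using hw1
  -- Independence is conditional independence given a constant.
  have h2 : cmi w A B (fun _ => ()) = 0 := by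
    rw [← h, cmi, mutInfo, shannon_congr hw (f := fun ω => (A ω, ())) (g := A) (by simp),
      shannon_congr hw (f := fun ω => (B ω, ())) (g := B) (by simp),
      shannon_congr hw (f := fun ω => (A ω, B ω, ())) (g := fun ω => (A ω, B ω)) (by simp),
      sub_eq_self]
    simp [shannon, h1]
  have := mass_mul_mass_of_cmi_eq_zero hw h2 a b ()
  simpa [h1] using this

theorem ingleton_nonneg_of_indep (hw : ∀ ω, 0 ≤ w ω) (hw1 : ∑ ω, w ω = 1)
    (A : Ω → α) (B : Ω → β) (C : Ω → γ) (D : Ω → δ)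
    (h1 : cmi w A B C = 0) (h2 : mutInfo w A B = 0) : 0 ≤ ingleton w A B C D := by
  refine ingleton_nonneg_of_condIndep hw A B C D h1 ?_
  refine sum_mul_eq_sum_condProd_of_split hw A B _
    (fun a b => Real.log (mass w fun ω => A ω = a ∧ B ω = b))
    (fun a _ => Real.log (mass w fun ω => A ω = a))
    (fun b _ => Real.log (mass w fun ω => B ω = b)) ?_ ?_
  · intro a b t ht
    obtain ⟨ha, hb, _⟩ := pos_of_condProd_pos hw ht
    rw [mass_eq_mul_of_mutInfo_eq_zero hw hw1 h2, Real.log_mul]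
    · exact (ha.trans_le (mass_mono hw fun ω h => h.1)).ne'
    · exact (hb.trans_le (mass_mono hw fun ω h => h.1)).ne'
  · intro ω hω
    rw [mass_eq_mul_of_mutInfo_eq_zero hw hw1 h2, Real.log_mul]
    · exact (mass_pos hw (ω := ω) (by rfl) hω).ne'
    · exact (mass_pos hw (ω := ω) (by rfl) hω).ne'

/-- The law of (A,B) itself survives: P(b|c,d) = P(b|c), so summing out d and then c turns the
conditional product back into P(a,b). -/
theorem ingleton_nonneg_of_condIndep_condIndep (hw : ∀ ω, 0 ≤ w ω)
    (A : Ω → α) (B : Ω → β) (C : Ω → γ) (D : Ω → δ)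
    (h1 : cmi w A B C = 0) (h2 : cmi w B D C = 0) : 0 ≤ ingleton w A B C D := by
  refine ingleton_nonneg_of_condIndep hw A B C D h1 ?_
  rw [sum_mul_eq_sum_mass w A B (fun a b => Real.log (mass w fun ω => A ω = a ∧ B ω = b))]
  refine Finset.sum_congr rfl fun a _ => Finset.sum_congr rfl fun b _ => ?_
  rw [← Finset.sum_mul]
  congr 1
  rw [Fintype.sum_prod_type, ← sum_mass_and w _ C]
  refine Finset.sum_congr rfl fun c _ => ?_
  have hcd : ∀ d, condProd w A B (fun ω => (C ω, D ω)) a b (c, d) =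
      mass w (fun ω => (A ω = a ∧ C ω = c) ∧ D ω = d) *
        (mass w (fun ω => B ω = b ∧ C ω = c) / mass w (fun ω => C ω = c)) := by
    intro d
    have e := mass_mul_mass_of_cmi_eq_zero hw h2 b d c
    unfold condProd
    simp only [Prod.mk.injEq]
    rw [mass_congr (E := fun ω => A ω = a ∧ C ω = c ∧ D ω = d)
        (F := fun ω => (A ω = a ∧ C ω = c) ∧ D ω = d) (fun _ => by tauto),
      mass_congr (E := fun ω => B ω = b ∧ C ω = c ∧ D ω = d)
        (F := fun ω => B ω = b ∧ D ω = d ∧ C ω = c) (fun _ => by tauto),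
      mass_congr (E := fun ω => C ω = c ∧ D ω = d)
        (F := fun ω => D ω = d ∧ C ω = c) (fun _ => by tauto)]
    rcases eq_or_ne (mass w fun ω => D ω = d ∧ C ω = c) 0 with h0 | h0
    · rw [mass_eq_zero_of_imp hw (E := fun ω => (A ω = a ∧ C ω = c) ∧ D ω = d)
        (fun ω h => ⟨h.2, h.1.2⟩) h0]
      simp
    · have h0' : mass w (fun ω => C ω = c) ≠ 0 := fun h =>
        h0 (mass_eq_zero_of_imp hw (fun ω h => h.2) h)
      field_simp
      rw [mul_assoc, e]
      ring
  simp only [hcd]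
  rw [← Finset.sum_mul, sum_mass_and]
  have e := mass_mul_mass_of_cmi_eq_zero hw h1 a b c
  rw [mass_congr (E := fun ω => (A ω = a ∧ B ω = b) ∧ C ω = c)
        (F := fun ω => A ω = a ∧ B ω = b ∧ C ω = c) (fun _ => by tauto)]
  rcases eq_or_ne (mass w fun ω => C ω = c) 0 with h0 | h0
  · rw [mass_eq_zero_of_imp hw (E := fun ω => A ω = a ∧ B ω = b ∧ C ω = c) (fun ω h => h.2.2) h0,
      h0]
    simp
  · rw [← mul_div_assoc, ← e, mul_div_cancel_right₀ _ h0]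

/-- If f is a function of g, the entropies compare outcome by outcome, so equality of the sums
forces equality of the terms. -/
theorem mass_eq_of_shannon_eq {α β : Type*} (hw : ∀ ω, 0 ≤ w ω) {f : Ω → α} {g : Ω → β}
    (h : ∀ ω ω', g ω' = g ω → f ω' = f ω) (he : shannon w g = shannon w f) {ω : Ω}
    (hω : 0 < w ω) : mass w (fun ω' => g ω' = g ω) = mass w (fun ω' => f ω' = f ω) := by
  have hle : ∀ ω ∈ Finset.univ, w ω * Real.log (mass w fun ω' => g ω' = g ω) ≤
      w ω * Real.log (mass w fun ω' => f ω' = f ω) := by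
    intro ω _
    rcases (hw ω).eq_or_lt with h0 | h0
    · simp [← h0]
    · have : 0 < mass w fun ω' => g ω' = g ω := mass_pos hw (ω := ω) rfl h0
      gcongr
      exact mass_mono hw fun ω' => h ω ω'
  have := (Finset.sum_eq_sum_iff_of_le hle).1 (neg_injective he) ω (Finset.mem_univ _)
  exact Real.log_injOn_pos (mass_pos hw (ω := ω) (by rfl) hω) (mass_pos hw (ω := ω) (by rfl) hω)
    (mul_left_cancel₀ hω.ne' this)

/-- Where P(a,b,c) > 0, the value c is determined by (a,b), so P(a,b) = P(a,b,c) = P(a,c) P(b,c) /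
P(c) and the logarithm splits. -/
theorem ingleton_nonneg_of_determined (hw : ∀ ω, 0 ≤ w ω)
    (A : Ω → α) (B : Ω → β) (C : Ω → γ) (D : Ω → δ) (h1 : cmi w A B C = 0)
    (h2 : shannon w (fun ω => (A ω, B ω, C ω)) = shannon w (fun ω => (A ω, B ω))) :
    0 ≤ ingleton w A B C D := by
  refine ingleton_nonneg_of_condIndep hw A B C D h1 ?_
  have key : ∀ a b c, 0 < mass w (fun ω => A ω = a ∧ B ω = b ∧ C ω = c) →
      Real.log (mass w fun ω => A ω = a ∧ B ω = b) =
        (Real.log (mass w fun ω => A ω = a ∧ C ω = c) - Real.log (mass w fun ω => C ω = c)) +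
        Real.log (mass w fun ω => B ω = b ∧ C ω = c) := by
    intro a b c habc
    have hac : 0 < mass w fun ω => A ω = a ∧ C ω = c :=
      habc.trans_le (mass_mono hw fun ω h => ⟨h.1, h.2.2⟩)
    have hbc : 0 < mass w fun ω => B ω = b ∧ C ω = c :=
      habc.trans_le (mass_mono hw fun ω h => h.2)
    have hc : 0 < mass w fun ω => C ω = c := hac.trans_le (mass_mono hw fun ω h => h.2)
    have hlog := congrArg Real.log (mass_mul_mass_of_cmi_eq_zero hw h1 a b c)
    rw [Real.log_mul habc.ne' hc.ne', Real.log_mul hac.ne' hbc.ne'] at hlog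
    obtain ⟨ω, hω, rfl, rfl, rfl⟩ := exists_pos_of_mass_pos hw habc
    have := mass_eq_of_shannon_eq hw (f := fun ω => (A ω, B ω)) (g := fun ω => (A ω, B ω, C ω))
      (by simp +contextual) h2 hω
    simp only [Prod.mk.injEq] at this
    rw [← this]
    linarith
  refine sum_mul_eq_sum_condProd_of_split hw A B (fun ω => (C ω, D ω))
    (fun a b => Real.log (mass w fun ω => A ω = a ∧ B ω = b))
    (fun a t => Real.log (mass w fun ω => A ω = a ∧ C ω = t.1) -
      Real.log (mass w fun ω => C ω = t.1))
    (fun b t => Real.log (mass w fun ω => B ω = b ∧ C ω = t.1)) ?_ ?_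
  · exact fun a b t ht => key a b t.1 (condIndep_pos hw h1 ht)
  · exact fun ω hω => key _ _ _ (mass_pos hw (ω := ω) ⟨rfl, rfl, rfl⟩ hω)

end IngletonConditions

/-! ### Passage between joint distributions in bits and variables on a weighted space in nats. -/

section Realization

variable {Ω : Type} [Fintype Ω] {n : ℕ} {V : Fin n → Type}

/-- The variables `X i` on the finite space `Ω` with weights `w` have the entropies of `P`. -/
def Realizes (w : Ω → ℝ) (X : ∀ i, Ω → V i) (P : JointDist n) : Prop :=
  (∀ ω, 0 ≤ w ω) ∧
    ∀ S, P.entropy S = shannon w (fun ω (i : S) => X i ω) / Real.log 2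

theorem JointDist.realizes (P : JointDist n) : Realizes P.prob (fun i x => x i) P := by
  classical
  refine ⟨P.prob_mem.1, fun S => ?_⟩
  have hm : ∀ x, P.marginal S x = mass P.prob (fun y => (fun i : S => y i) = x) := by
    intro x
    rw [JointDist.marginal, Finset.sum_filter, mass]
    refine Finset.sum_congr rfl fun y _ => ?_
    simp only [funext_iff]
  simp only [JointDist.entropy, hm]
  rw [sum_mass_mul P.prob (fun y (i : S) => y i) (fun x =>
    Real.logb 2 (1 / mass P.prob (fun y => (fun i : S => y i) = x))), shannon,
    ← Finset.sum_neg_distrib, Finset.sum_div]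
  refine Finset.sum_congr rfl fun y _ => ?_
  rw [one_div, Real.logb_inv, Real.logb]
  ring

open Classical in
/-- The joint distribution of the variables `X i` on the finite space `Ω` with weights `w`. -/
noncomputable def JointDist.ofVariables [∀ i, Fintype (V i)] (w : Ω → ℝ) (hw : ∀ ω, 0 ≤ w ω)
    (hw1 : ∑ ω, w ω = 1) (X : ∀ i, Ω → V i) : JointDist n where
  Val := V
  fintypeVal := inferInstance
  decEqVal := inferInstance
  prob x := mass w (fun ω => (fun i => X i ω) = x)
  prob_mem := ⟨fun _ => mass_nonneg hw _, by rw [sum_mass, hw1]⟩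

theorem mass_mass {α : Type*} [Fintype α] (w : Ω → ℝ) (f : Ω → α) (E : α → Prop) :
    mass (fun a => mass w (fun ω => f ω = a)) E = mass w (fun ω => E (f ω)) := by
  classical
  have := sum_mass_mul w f (fun a => if E a then 1 else 0)
  unfold mass at *
  simp only [mul_ite, mul_one, mul_zero] at this
  refine Eq.trans ?_ (this.trans ?_)
  · exact Finset.sum_congr rfl fun a _ => by split_ifs <;> rfl
  · exact Finset.sum_congr rfl fun a _ => by split_ifs <;> rfl

theorem shannon_mass {α β : Type*} [Fintype α] (w : Ω → ℝ) (f : Ω → α) (g : α → β) :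
    shannon (fun a => mass w (fun ω => f ω = a)) g = shannon w (fun ω => g (f ω)) := by
  unfold shannon
  rw [sum_mass_mul w f]
  simp only [mass_mass]

theorem JointDist.realizes_ofVariables [∀ i, Fintype (V i)] (w : Ω → ℝ) (hw : ∀ ω, 0 ≤ w ω)
    (hw1 : ∑ ω, w ω = 1) (X : ∀ i, Ω → V i) :
    Realizes w X (JointDist.ofVariables w hw hw1 X) := by
  classical
  refine ⟨hw, fun S => ?_⟩
  rw [(JointDist.ofVariables w hw hw1 X).realizes.2 S]
  congr 1
  exact shannon_mass w (fun ω i => X i ω) _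

theorem eval_add (κ μ : EntropyForm n) (P : JointDist n) :
    (κ + μ).eval P = κ.eval P + μ.eval P := by
  simp [EntropyForm.eval, add_mul, Finset.sum_add_distrib]

theorem eval_sub (κ μ : EntropyForm n) (P : JointDist n) :
    (κ - μ).eval P = κ.eval P - μ.eval P := by
  simp [EntropyForm.eval, sub_mul, Finset.sum_sub_distrib]

theorem eval_ent {S : Finset (Fin n)} (hS : S.Nonempty) (P : JointDist n) :
    (ent S).eval P = P.entropy S := by
  unfold EntropyForm.eval ent
  rw [Finset.sum_eq_single ⟨S, hS⟩]
  · simp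
  · intro T _ hT
    have : T.1 ≠ S := fun h => hT (Subtype.ext h)
    simp [this]
  · simp

namespace Realizes

variable {w : Ω → ℝ} {X : ∀ i, Ω → V i} {P : JointDist n}

theorem entropy_eq (h : Realizes w X P) {α : Type*} {f : Ω → α} {S : Finset (Fin n)}
    (hS : S.Nonempty) (hf : ∀ ω ω', (∀ i ∈ S, X i ω' = X i ω) ↔ f ω' = f ω) :
    (ent S).eval P = shannon w f / Real.log 2 := by
  rw [eval_ent hS, h.2]
  congr 1
  refine shannon_congr h.1 fun ω ω' _ _ => ?_
  rw [← hf, funext_iff, Subtype.forall]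

theorem eval_mutualInfo (h : Realizes w X P) (i j : Fin n) :
    (mutualInfo i j).eval P = mutInfo w (X i) (X j) / Real.log 2 := by
  rw [mutualInfo, eval_sub, eval_add, h.entropy_eq (f := X i) (by simp) (by simp),
    h.entropy_eq (f := X j) (by simp) (by simp),
    h.entropy_eq (f := fun ω => (X i ω, X j ω)) (by simp) (by simp), mutInfo]
  ring

theorem eval_condMutualInfo (h : Realizes w X P) (i j k : Fin n) :
    (condMutualInfo i j k).eval P = cmi w (X i) (X j) (X k) / Real.log 2 := by
  rw [condMutualInfo, eval_sub, eval_sub, eval_add,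
    h.entropy_eq (f := fun ω => (X i ω, X k ω)) (by simp) (by simp),
    h.entropy_eq (f := fun ω => (X j ω, X k ω)) (by simp) (by simp),
    h.entropy_eq (f := fun ω => (X i ω, X j ω, X k ω)) (by simp) (by simp),
    h.entropy_eq (f := X k) (by simp) (by simp), cmi]
  ring

theorem eval_condEnt₂ (h : Realizes w X P) (k i j : Fin n) :
    (condEnt₂ k i j).eval P = (shannon w (fun ω => (X i ω, X j ω, X k ω)) -
      shannon w (fun ω => (X i ω, X j ω))) / Real.log 2 := by
  rw [condEnt₂, eval_sub, h.entropy_eq (f := fun ω => (X i ω, X j ω, X k ω)) (by simp) (by simp),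
    h.entropy_eq (f := fun ω => (X i ω, X j ω)) (by simp) (by simp)]
  ring

theorem eval_box (h : Realizes w X P) (i j k l : Fin n) :
    (box i j k l).eval P = ingleton w (X i) (X j) (X k) (X l) / Real.log 2 := by
  rw [box, eval_sub, eval_add, eval_add, h.eval_condMutualInfo, h.eval_condMutualInfo,
    h.eval_mutualInfo, h.eval_mutualInfo, ingleton]
  ring

theorem eval_condMutualInfo_nonneg (h : Realizes w X P) (i j k : Fin n) :
    0 ≤ (condMutualInfo i j k).eval P := by
  rw [h.eval_condMutualInfo]
  exact div_nonneg (cmi_nonneg h.1 _ _ _) (Real.log_pos one_lt_two).le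

end Realizes

theorem cmi_eq_zero_of_eval (P : JointDist n) {i j k : Fin n}
    (h : (condMutualInfo i j k).eval P = 0) :
    cmi P.prob (fun x => x i) (fun x => x j) (fun x => x k) = 0 := by
  rw [P.realizes.eval_condMutualInfo, div_eq_zero_iff] at h
  exact h.resolve_right (Real.log_pos one_lt_two).ne'

theorem box_nonneg_of_ingleton (P : JointDist n) {i j k l : Fin n}
    (h : 0 ≤ ingleton P.prob (fun x => x i) (fun x => x j) (fun x => x k) (fun x => x l)) :
    0 ≤ (box i j k l).eval P := by
  rw [P.realizes.eval_box]
  exact div_nonneg h (Real.log_pos one_lt_two).le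

theorem box_nonneg_of_indep (P : JointDist n) {i j k : Fin n} (l : Fin n)
    (h1 : (condMutualInfo i j k).eval P = 0) (h2 : (mutualInfo i j).eval P = 0) :
    0 ≤ (box i j k l).eval P := by
  rw [P.realizes.eval_mutualInfo, div_eq_zero_iff] at h2
  exact box_nonneg_of_ingleton P (ingleton_nonneg_of_indep P.prob_mem.1 P.prob_mem.2 _ _ _ _
    (cmi_eq_zero_of_eval P h1) (h2.resolve_right (Real.log_pos one_lt_two).ne'))

theorem box_nonneg_of_condIndep_condIndep (P : JointDist n) {i j k l : Fin n}
    (h1 : (condMutualInfo i j k).eval P = 0) (h2 : (condMutualInfo j l k).eval P = 0) :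
    0 ≤ (box i j k l).eval P :=
  box_nonneg_of_ingleton P (ingleton_nonneg_of_condIndep_condIndep P.prob_mem.1 _ _ _ _
    (cmi_eq_zero_of_eval P h1) (cmi_eq_zero_of_eval P h2))

theorem box_nonneg_of_determined (P : JointDist n) {i j k : Fin n} (l : Fin n)
    (h1 : (condMutualInfo i j k).eval P = 0) (h2 : (condEnt₂ k i j).eval P = 0) :
    0 ≤ (box i j k l).eval P := by
  rw [P.realizes.eval_condEnt₂, div_eq_zero_iff] at h2
  exact box_nonneg_of_ingleton P (ingleton_nonneg_of_determined P.prob_mem.1 _ _ _ _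
    (cmi_eq_zero_of_eval P h1)
    (sub_eq_zero.1 (h2.resolve_right (Real.log_pos one_lt_two).ne')))

theorem box_nonneg_of_markov_left (P : JointDist n) {i k l : Fin n} (j : Fin n)
    (h1 : (condMutualInfo i l k).eval P = 0) (h2 : (condMutualInfo i k l).eval P = 0) :
    0 ≤ (box i j k l).eval P :=
  box_nonneg_of_ingleton P (ingleton_nonneg_of_markov_left P.prob_mem.1 _ _ _ _
    (cmi_eq_zero_of_eval P h1) (cmi_eq_zero_of_eval P h2))

theorem box_nonneg_of_markov_right (P : JointDist n) {j k l : Fin n} (i : Fin n)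
    (h1 : (condMutualInfo j k l).eval P = 0) (h2 : (condMutualInfo k l j).eval P = 0) :
    0 ≤ (box i j k l).eval P :=
  box_nonneg_of_ingleton P (ingleton_nonneg_of_markov_right P.prob_mem.1 _ _ _ _
    (cmi_eq_zero_of_eval P h1) (cmi_eq_zero_of_eval P h2))

end Realization

/-! ### Counterexamples from conjunction and disjunction. -/

section Examples

/-- The outcomes are the values 00, 01, 10, 11 of two bits A, B, with C = A ∧ B and D = A ∨ B. Sums
are bracketed as the expansion of the masses yields them. -/
theorem ingleton_and_or (a b c d : ℝ) :
    ingleton ![a, b, c, d] ![false, false, true, true] ![false, true, false, true]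
      ![false, false, false, true] ![false, true, true, true] =
    a * Real.log a + b * Real.log b + c * Real.log c + d * Real.log d
      + (a + (b + c)) * Real.log (a + (b + c)) + (b + (c + d)) * Real.log (b + (c + d))
      - (b + c) * Real.log (b + c) - (a + b) * Real.log (a + b) - (c + d) * Real.log (c + d)
      - (a + c) * Real.log (a + c) - (b + d) * Real.log (b + d) := by
  simp [ingleton, cmi, mutInfo, shannon, mass, Fin.sum_univ_succ]
  ring

theorem ingleton_and_or_swap (a b c d : ℝ) :
    ingleton ![a, b, c, d] ![false, true, false, true] ![false, false, true, true]
      ![false, false, false, true] ![false, true, true, true] =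
    ingleton ![a, b, c, d] ![false, false, true, true] ![false, true, false, true]
      ![false, false, false, true] ![false, true, true, true] := by
  simp [ingleton, cmi, mutInfo, shannon, mass, Fin.sum_univ_succ]
  ring

theorem cmi_inputs_and (a b c d : ℝ) :
    cmi ![a, b, c, d] ![false, false, true, true] ![false, true, false, true]
      ![false, false, false, true] =
    (a + (b + c)) * Real.log (a + (b + c)) + a * Real.log a - (a + b) * Real.log (a + b)
      - (a + c) * Real.log (a + c) := by
  simp [cmi, shannon, mass, Fin.sum_univ_succ]
  ring

theorem cmi_input_or_and (a b c d : ℝ) :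
    cmi ![a, b, c, d] ![false, true, false, true] ![false, true, true, true]
      ![false, false, false, true] =
    (a + (b + c)) * Real.log (a + (b + c)) + c * Real.log c - (a + c) * Real.log (a + c)
      - (b + c) * Real.log (b + c) := by
  simp [cmi, shannon, mass, Fin.sum_univ_succ]
  ring

theorem cmi_input_and_or (a b c d : ℝ) :
    cmi ![a, b, c, d] ![false, false, true, true] ![false, false, false, true]
      ![false, true, true, true] =
    (b + (c + d)) * Real.log (b + (c + d)) + c * Real.log c - (c + d) * Real.log (c + d)
      - (b + c) * Real.log (b + c) := by
  simp [cmi, shannon, mass, Fin.sum_univ_succ]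
  ring

/-- A false input fixes the conjunction and a true input fixes the disjunction, so given an input
one of the two is constant. -/
theorem cmi_and_or_input (a b c d : ℝ) :
    cmi ![a, b, c, d] ![false, false, false, true] ![false, true, true, true]
      ![false, false, true, true] = 0 := by
  simp [cmi, shannon, mass, Fin.sum_univ_succ]
  ring

theorem shannon_and_sub (a b c d : ℝ) :
    shannon ![a, b, c, d] (fun ω => ((![false, false, true, true] : Fin 4 → Bool) ω,
        (![false, true, false, true] : Fin 4 → Bool) ω,
        (![false, false, false, true] : Fin 4 → Bool) ω)) -
      shannon ![a, b, c, d] (fun ω => ((![false, false, true, true] : Fin 4 → Bool) ω,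
        (![false, true, false, true] : Fin 4 → Bool) ω)) = 0 := by
  simp [shannon, mass, Fin.sum_univ_succ]

/-- Two bits with their conjunction and their disjunction, when the weight `y` of the outcome
`(0, 1)` of the bits is small: the Ingleton expression is of order `y * log y`. -/
theorem and_or_bounds {y : ℝ} (hy : 0 < y) (hy' : y ≤ 1 / 4) :
    ingleton ![1 / 4, y, 1 / 2 - y, 1 / 4] ![false, false, true, true] ![false, true, false, true]
      ![false, false, false, true] ![false, true, true, true] ≤ y * (Real.log y + 7) ∧
    cmi ![1 / 4, y, 1 / 2 - y, 1 / 4] ![false, false, true, true] ![false, true, false, true]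
      ![false, false, false, true] ≤ 6 * y ∧
    cmi ![1 / 4, y, 1 / 2 - y, 1 / 4] ![false, true, false, true] ![false, true, true, true]
      ![false, false, false, true] ≤ 6 * y ∧
    cmi ![1 / 4, y, 1 / 2 - y, 1 / 4] ![false, false, true, true] ![false, false, false, true]
      ![false, true, true, true] ≤ 6 * y := by
  rw [ingleton_and_or, cmi_inputs_and, cmi_input_or_and, cmi_input_and_or]
  have s1 : (1 : ℝ) / 4 + (y + (1 / 2 - y)) = 3 / 4 := by ring
  have s2 : y + ((1 : ℝ) / 2 - y + 1 / 4) = 3 / 4 := by ring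
  have s3 : y + ((1 : ℝ) / 2 - y) = 1 / 2 := by ring
  have s4 : (1 : ℝ) / 2 - y + 1 / 4 = 3 / 4 - y := by ring
  have s5 : (1 : ℝ) / 4 + (1 / 2 - y) = 3 / 4 - y := by ring
  rw [s1, s2, s3, s4, s5, add_comm y (1 / 4)]
  have k1 : Real.log (3 / 4) - Real.log (3 / 4 - y) ≤ 4 * y := by
    rw [← Real.log_div (by norm_num) (by linarith)]
    refine (Real.log_le_sub_one_of_pos (div_pos (by norm_num) (by linarith))).trans ?_
    rw [div_sub_one (by linarith), div_le_iff₀ (by linarith)]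
    nlinarith
  have k2 : Real.log (1 / 4) ≤ Real.log (1 / 4 + y) :=
    Real.log_le_log (by norm_num) (by linarith)
  have k3 : Real.log (1 / 2 - y) ≤ Real.log (1 / 2) :=
    Real.log_le_log (by linarith) (by linarith)
  have k4 : Real.log (3 / 4 - y) ≤ 0 := Real.log_nonpos (by linarith) (by linarith)
  have k5 : -3 ≤ Real.log (1 / 4) := by
    rw [one_div, Real.log_inv, neg_le_neg_iff]
    linarith [Real.log_le_sub_one_of_pos (show (0 : ℝ) < 4 by norm_num)]
  have k6 : -1 ≤ Real.log (1 / 2) := by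
    rw [one_div, Real.log_inv, neg_le_neg_iff]
    linarith [Real.log_le_sub_one_of_pos (show (0 : ℝ) < 2 by norm_num)]
  have k7 : Real.log (3 / 4) ≤ 0 := Real.log_nonpos (by norm_num) (by norm_num)
  -- These tangent-line bounds, with k1–k7, replace every logarithm except log y by estimates linear
  -- in y.
  have g1 := mul_log_sub_le (p := 1 / 4 + y) (q := 1 / 4) (by linarith) (by norm_num)
    (fun _ => by norm_num)
  have g2 := mul_log_sub_le (p := 3 / 4 - y) (q := 3 / 4) (by linarith) (by norm_num)
    (fun _ => by norm_num)
  have m1 := mul_nonneg hy.le (neg_nonneg.2 k4)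
  have m2 := mul_nonneg hy.le (sub_nonneg.2 k2)
  have m3 := mul_nonneg (show 0 ≤ 1 / 2 - y by linarith) (sub_nonneg.2 k3)
  have m5 := mul_nonneg hy.le (sub_nonneg.2 k5)
  have m6 := mul_nonneg hy.le (sub_nonneg.2 k6)
  have m7 := mul_nonneg hy.le (neg_nonneg.2 k7)
  refine ⟨?_, ?_, ?_, ?_⟩ <;> linarith

theorem exists_and_or (K : ℝ) (hK : 0 ≤ K) : ∃ y : ℝ, 0 < y ∧ y ≤ 1 / 4 ∧
    y * (Real.log y + 7) + K * (12 * y) < 0 := by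
  refine ⟨Real.exp (-(8 + 12 * K)), Real.exp_pos _, ?_, ?_⟩
  -- The witness has log y = -(8 + 12K), so the expression in question equals -y.
  · rw [Real.exp_neg, one_div]
    refine inv_anti₀ (by norm_num) ?_
    linarith [Real.add_one_le_exp (8 + 12 * K)]
  · rw [Real.log_exp]
    nlinarith [Real.exp_pos (-(8 + 12 * K))]

/-- The last two variables are the conjunction of the first two, kept only in a part of the
outcomes, and their disjunction. -/
theorem ingleton_rare_and (a b c d f : ℝ) :
    ingleton ![a, b, c, d, f] ![false, false, true, true, true] ![false, true, false, true, true]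
      ![false, false, false, false, true] ![false, true, true, true, true] =
    mutInfo ![a, b, c, d, f] ![false, false, true, true, true] ![false, true, false, true, true]
      + (a + (b + (c + d))) * Real.log (a + (b + (c + d)))
      + (b + (c + (d + f))) * Real.log (b + (c + (d + f)))
      - (b + (c + d)) * Real.log (b + (c + d)) := by
  simp [ingleton, cmi, mutInfo, shannon, mass, Fin.sum_univ_succ]
  ring

theorem mutInfo_rare_and (a b c d f : ℝ) :
    mutInfo ![a, b, c, d, f] ![false, false, true, true, true] ![false, true, false, true, true] =
    a * Real.log a + b * Real.log b + c * Real.log c + (d + f) * Real.log (d + f)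
      - (a + b) * Real.log (a + b) - (c + (d + f)) * Real.log (c + (d + f))
      - (a + c) * Real.log (a + c) - (b + (d + f)) * Real.log (b + (d + f)) := by
  simp [mutInfo, shannon, mass, Fin.sum_univ_succ]
  ring

/-- Given that the third variable is false, the two bits are uniform and independent; given that it
is true, they are constant. -/
theorem cmi_rare_and (a f : ℝ) (ha : 0 < a) :
    cmi ![a, a, a, a, f] ![false, false, true, true, true] ![false, true, false, true, true]
      ![false, false, false, false, true] = 0 := by
  have h2 : Real.log (a + a) = Real.log 2 + Real.log a := by
    rw [← two_mul, Real.log_mul two_ne_zero ha.ne']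
  have h4 : Real.log (a + (a + (a + a))) = 2 * Real.log 2 + Real.log a := by
    rw [show a + (a + (a + a)) = 2 * (2 * a) by ring, Real.log_mul two_ne_zero (by positivity),
      Real.log_mul two_ne_zero ha.ne']
    ring
  simp [cmi, shannon, mass, Fin.sum_univ_succ]
  rw [h2, h4]
  ring

/-- To first order in e the mutual information vanishes and the other contributions cancel except e
log(3/4), which is at most -e/4. -/
theorem rare_and_bounds {e : ℝ} (he : 0 < e) (he' : e < 1) :
    mutInfo ![(1 - e) / 4, (1 - e) / 4, (1 - e) / 4, (1 - e) / 4, e]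
      ![false, false, true, true, true] ![false, true, false, true, true] ≤ 9 / 4 * e ^ 2 ∧
    ingleton ![(1 - e) / 4, (1 - e) / 4, (1 - e) / 4, (1 - e) / 4, e]
      ![false, false, true, true, true] ![false, true, false, true, true]
      ![false, false, false, false, true] ![false, true, true, true, true] ≤
    9 / 4 * e ^ 2 + e ^ 2 / 3 - e / 4 := by
  have hI : mutInfo ![(1 - e) / 4, (1 - e) / 4, (1 - e) / 4, (1 - e) / 4, e]
      ![false, false, true, true, true] ![false, true, false, true, true] ≤ 9 / 4 * e ^ 2 := by
    rw [mutInfo_rare_and]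
    have s1 : (1 - e) / 4 + e = (1 + 3 * e) / 4 := by ring
    have s2 : (1 - e) / 4 + (1 + 3 * e) / 4 = (1 + e) / 2 := by ring
    have s3 : (1 - e) / 4 + (1 - e) / 4 = (1 - e) / 2 := by ring
    rw [s1, s2, s3, Real.log_div (by linarith) (by norm_num), Real.log_div (by linarith)
      (by norm_num), Real.log_div (by linarith) (by norm_num), Real.log_div (by linarith)
      (by norm_num), show Real.log 4 = 2 * Real.log 2 by
        rw [show (4 : ℝ) = 2 ^ 2 by norm_num, Real.log_pow]; norm_num]
    have l1 := mul_log_sub_le (p := 1 - e) (q := 1) (by linarith) (by norm_num)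
      (fun _ => by norm_num)
    have l2 := mul_log_sub_le (p := 1 + e) (q := 1) (by linarith) (by norm_num)
      (fun _ => by norm_num)
    have l3 : Real.log (1 + 3 * e) ≤ 3 * e := by
      linarith [Real.log_le_sub_one_of_pos (show 0 < 1 + 3 * e by linarith)]
    have m3 := mul_le_mul_of_nonneg_left l3 (show 0 ≤ 1 + 3 * e by linarith)
    rw [Real.log_one] at l1 l2
    linarith
  refine ⟨hI, ?_⟩
  rw [ingleton_rare_and]
  have s1 : (1 - e) / 4 + ((1 - e) / 4 + ((1 - e) / 4 + (1 - e) / 4)) = 1 - e := by ring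
  have s2 : (1 - e) / 4 + ((1 - e) / 4 + ((1 - e) / 4 + e)) = 3 / 4 * (1 + e / 3) := by ring
  have s3 : (1 - e) / 4 + ((1 - e) / 4 + (1 - e) / 4) = 3 / 4 * (1 - e) := by ring
  rw [s1, s2, s3, Real.log_mul (by norm_num) (by linarith), Real.log_mul (by norm_num)
    (by linarith)]
  have l1 : Real.log (1 - e) ≤ -e := by
    linarith [Real.log_le_sub_one_of_pos (show 0 < 1 - e by linarith)]
  have l2 : Real.log (1 + e / 3) ≤ e / 3 := by
    linarith [Real.log_le_sub_one_of_pos (show 0 < 1 + e / 3 by linarith)]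
  have l3 : Real.log (3 / 4) ≤ -(1 / 4) := by
    linarith [Real.log_le_sub_one_of_pos (show (0 : ℝ) < 3 / 4 by norm_num)]
  have m1 := mul_le_mul_of_nonneg_left l1 (show 0 ≤ (1 - e) by linarith)
  have m2 := mul_le_mul_of_nonneg_left l2 (show 0 ≤ 3 / 4 * (1 + e / 3) by linarith)
  have m3 := mul_le_mul_of_nonneg_left l3 he.le
  linarith

end Examples

/-! ### Counterexample for the constraints I(A:D|C) = I(A:C|D) = 0. -/

section CrossingExample

/-- In the intended weights A and B are independent uniform bits and C = D = B, except that with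
conditional probability x, when A ≠ B, the pair (C,D) is replaced by (0,1): these are the last two
outcomes. -/
theorem ingleton_crossing (a b c d e f : ℝ) :
    ingleton ![a, b, c, d, e, f] ![false, false, true, true, false, true]
      ![false, true, false, true, true, false] ![false, true, false, true, false, false]
      ![false, true, false, true, true, true] =
    a * Real.log a + b * Real.log b + c * Real.log c + d * Real.log d + e * Real.log e
      + f * Real.log f + (a + c) * Real.log (a + c) + (b + d) * Real.log (b + d)
      + e * Real.log e + f * Real.log f
      + a * Real.log a + (b + e) * Real.log (b + e) + (c + f) * Real.log (c + f) + d * Real.log d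
      + (a + (c + (e + f))) * Real.log (a + (c + (e + f))) + (b + d) * Real.log (b + d)
      + (a + c) * Real.log (a + c) + (b + (d + (e + f))) * Real.log (b + (d + (e + f)))
      - (a + e) * Real.log (a + e) - b * Real.log b - (c + f) * Real.log (c + f) - d * Real.log d
      - a * Real.log a - (b + e) * Real.log (b + e) - c * Real.log c - (d + f) * Real.log (d + f)
      - (a + (c + f)) * Real.log (a + (c + f)) - (b + d) * Real.log (b + d) - e * Real.log e
      - (a + c) * Real.log (a + c) - (b + (d + e)) * Real.log (b + (d + e)) - f * Real.log f
      - (a + c) * Real.log (a + c) - (b + d) * Real.log (b + d)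
      - (e + f) * Real.log (e + f) := by
  simp [ingleton, cmi, mutInfo, shannon, mass, Fin.sum_univ_succ]
  ring

theorem cmi_crossing_left (a b c d e f : ℝ) :
    cmi ![a, b, c, d, e, f] ![false, false, true, true, false, true]
      ![false, true, false, true, true, true] ![false, true, false, true, false, false] =
    a * Real.log a + b * Real.log b + c * Real.log c + d * Real.log d + e * Real.log e
      + f * Real.log f + (a + (c + (e + f))) * Real.log (a + (c + (e + f)))
      + (b + d) * Real.log (b + d)
      - (a + e) * Real.log (a + e) - b * Real.log b - (c + f) * Real.log (c + f) - d * Real.log d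
      - (a + c) * Real.log (a + c) - (b + d) * Real.log (b + d)
      - (e + f) * Real.log (e + f) := by
  simp [cmi, shannon, mass, Fin.sum_univ_succ]
  ring

theorem cmi_crossing_right (a b c d e f : ℝ) :
    cmi ![a, b, c, d, e, f] ![false, false, true, true, false, true]
      ![false, true, false, true, false, false] ![false, true, false, true, true, true] =
    a * Real.log a + b * Real.log b + c * Real.log c + d * Real.log d + e * Real.log e
      + f * Real.log f + (a + c) * Real.log (a + c)
      + (b + (d + (e + f))) * Real.log (b + (d + (e + f)))
      - a * Real.log a - (b + e) * Real.log (b + e) - c * Real.log c - (d + f) * Real.log (d + f)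
      - (a + c) * Real.log (a + c) - (b + d) * Real.log (b + d)
      - (e + f) * Real.log (e + f) := by
  simp [cmi, shannon, mass, Fin.sum_univ_succ]
  ring

/-- Second order is needed because in the crossing example the terms in x and in x log x cancel. -/
theorem abs_log_one_add_sub_le {t : ℝ} (ht : |t| ≤ 1 / 2) :
    |Real.log (1 + t) - (t - t ^ 2 / 2)| ≤ 2 * |t| ^ 3 := by
  have h := Real.abs_log_sub_add_sum_range_le (x := -t) (by rw [abs_neg]; linarith) 2
  have e : ∑ i ∈ Finset.range 2, (-t) ^ (i + 1) / ((i : ℝ) + 1) + Real.log (1 - -t) =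
      Real.log (1 + t) - (t - t ^ 2 / 2) := by
    simp [Finset.sum_range_succ]
    ring
  rw [e, abs_neg] at h
  refine h.trans ?_
  rw [div_le_iff₀ (by linarith)]
  have : 0 ≤ |t| ^ 3 := by positivity
  norm_num
  nlinarith

/-- Given C = 0, the joint table of (A,D) has determinant of order x² while the event D = 1 has
probability of order x, so the dependence costs only about x⁴ / x = x³. The case of (A,C) given D =
1 is symmetric. The Ingleton expression keeps a negative x² term. -/
theorem crossing_bounds {x : ℝ} (hx : 0 < x) (hx' : x ≤ 1 / 2) :
    ingleton ![1 / 4, (1 - x) / 4, (1 - x) / 4, 1 / 4, x / 4, x / 4]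
      ![false, false, true, true, false, true]
      ![false, true, false, true, true, false] ![false, true, false, true, false, false]
      ![false, true, false, true, true, true] ≤ 4 * x ^ 3 - x ^ 2 / 8 ∧
    cmi ![1 / 4, (1 - x) / 4, (1 - x) / 4, 1 / 4, x / 4, x / 4]
      ![false, false, true, true, false, true]
      ![false, true, false, true, true, true] ![false, true, false, true, false, false] ≤
        2 * x ^ 3 ∧
    cmi ![1 / 4, (1 - x) / 4, (1 - x) / 4, 1 / 4, x / 4, x / 4]
      ![false, false, true, true, false, true]
      ![false, true, false, true, false, false] ![false, true, false, true, true, true] ≤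
        2 * x ^ 3 := by
  rw [ingleton_crossing, cmi_crossing_left, cmi_crossing_right]
  have s1 : (1 - x) / 4 + x / 4 = 1 / 4 := by ring
  have s2 : 1 / 4 + x / 4 = (1 + x) / 4 := by ring
  have s3 : 1 / 4 + (1 - x) / 4 = (1 - x / 2) / 2 := by ring
  have s4 : (1 - x) / 4 + 1 / 4 = (1 - x / 2) / 2 := by ring
  have s5 : x / 4 + x / 4 = x / 2 := by ring
  have s6 : (1 : ℝ) / 4 + 1 / 4 = 1 / 2 := by ring
  have s7 : (1 - x) / 4 + (1 + x) / 4 = 1 / 2 := by ring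
  have s8 : 1 / 4 + ((1 - x) / 4 + x / 2) = (1 + x / 2) / 2 := by ring
  have s9 : (1 - x) / 4 + (1 / 4 + x / 2) = (1 + x / 2) / 2 := by ring
  rw [s5, s8, s9, s2, s1, s3, s4, s6, s7]
  have b1 := abs_le.1 (abs_log_one_add_sub_le (t := x) (by rw [abs_of_pos hx]; exact hx'))
  have b2 := abs_le.1 (abs_log_one_add_sub_le (t := -x)
    (by rw [abs_neg, abs_of_pos hx]; exact hx'))
  have b3 := abs_le.1 (abs_log_one_add_sub_le (t := x / 2)
    (by rw [abs_of_pos (by linarith)]; linarith))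
  have b4 := abs_le.1 (abs_log_one_add_sub_le (t := -(x / 2))
    (by rw [abs_neg, abs_of_pos (by linarith)]; linarith))
  rw [abs_of_pos hx] at b1
  rw [abs_neg, abs_of_pos hx, ← sub_eq_add_neg] at b2
  rw [abs_of_pos (show 0 < x / 2 by linarith)] at b3
  rw [abs_neg, abs_of_pos (show 0 < x / 2 by linarith), ← sub_eq_add_neg] at b4
  have l4 : Real.log 4 = 2 * Real.log 2 := by
    rw [show (4 : ℝ) = 2 ^ 2 by norm_num, Real.log_pow]
    norm_num
  rw [Real.log_div one_ne_zero (by norm_num : (4 : ℝ) ≠ 0),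
    Real.log_div one_ne_zero (by norm_num : (2 : ℝ) ≠ 0),
    Real.log_div (show 1 - x ≠ 0 by linarith) (by norm_num : (4 : ℝ) ≠ 0),
    Real.log_div (show 1 + x ≠ 0 by linarith) (by norm_num : (4 : ℝ) ≠ 0),
    Real.log_div (show 1 - x / 2 ≠ 0 by linarith) (by norm_num : (2 : ℝ) ≠ 0),
    Real.log_div (show 1 + x / 2 ≠ 0 by linarith) (by norm_num : (2 : ℝ) ≠ 0),
    Real.log_div hx.ne' (by norm_num : (4 : ℝ) ≠ 0),
    Real.log_div hx.ne' (by norm_num : (2 : ℝ) ≠ 0), l4, Real.log_one]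
  have p1 : 0 ≤ 1 + x := by linarith
  have p2 : 0 ≤ 1 - x := by linarith
  have p3 : 0 ≤ 1 + x / 2 := by linarith
  have p4 : 0 ≤ 1 - x / 2 := by linarith
  have u1 := mul_le_mul_of_nonneg_left b1.1 p1
  have u2 := mul_le_mul_of_nonneg_left b2.2 p2
  have u3 := mul_le_mul_of_nonneg_left b3.2 p3
  have u4 := mul_le_mul_of_nonneg_left b4.1 p4
  have hx3 : 0 ≤ x ^ 3 := by positivity
  have hx4 : x ^ 4 ≤ x ^ 3 / 2 := by nlinarith
  have hx4' : 0 ≤ x ^ 4 := by positivity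
  refine ⟨?_, ?_, ?_⟩ <;> nlinarith
end CrossingExample

/-! ### Defeating all multipliers, and assembly of the eight statements. -/

section EssentiallyConditional

theorem cmi_self_right {Ω α β : Type*} [Fintype Ω] {w : Ω → ℝ} (hw : ∀ ω, 0 ≤ w ω) (f : Ω → α)
    (g : Ω → β) : cmi w f g g = 0 := by
  rw [cmi, shannon_congr hw (f := fun ω => (g ω, g ω)) (g := g) (by simp),
    shannon_congr hw (f := fun ω => (f ω, g ω, g ω)) (g := fun ω => (f ω, g ω)) (by simp)]
  ring

theorem cmi_self_left {Ω α β : Type*} [Fintype Ω] {w : Ω → ℝ} (hw : ∀ ω, 0 ≤ w ω) (f : Ω → α)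
    (g : Ω → β) : cmi w g f g = 0 := by
  rw [cmi, shannon_congr hw (f := fun ω => (g ω, g ω)) (g := g) (by simp),
    shannon_congr hw (f := fun ω => (g ω, f ω, g ω)) (g := fun ω => (f ω, g ω))
      (by simp only [Prod.mk.injEq]; tauto)]
  ring

theorem mutInfo_nonneg {Ω α β : Type*} [Fintype Ω] {w : Ω → ℝ} (hw : ∀ ω, 0 ≤ w ω)
    (hw1 : ∑ ω, w ω = 1) (f : Ω → α) (g : Ω → β) : 0 ≤ mutInfo w f g := by
  have h := cmi_nonneg hw f g (fun _ => ())
  have h0 : shannon w (fun _ => ()) = 0 := by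
    have h1 : mass w (fun _ => True) = 1 := by simpa [mass] using hw1
    simp [shannon, h1]
  rwa [cmi, shannon_congr hw (f := fun ω => (f ω, ())) (g := f) (by simp),
    shannon_congr hw (f := fun ω => (g ω, ())) (g := g) (by simp),
    shannon_congr hw (f := fun ω => (f ω, g ω, ())) (g := fun ω => (f ω, g ω)) (by simp),
    h0, sub_zero] at h

/-- Since b and b' are nonnegative, each multiplier may be enlarged to |c 0| + |c 1|, which leaves a
single parameter for the examples to beat. -/
theorem eval_combination_neg {n : ℕ} {P : JointDist n} {κ μ ν : EntropyForm n} {a b b' : ℝ}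
    (ha : κ.eval P = a / Real.log 2) (hb : μ.eval P = b / Real.log 2)
    (hb' : ν.eval P = b' / Real.log 2) (hb0 : 0 ≤ b) (hb0' : 0 ≤ b') (c : Fin 2 → ℝ)
    (h : a + (|c 0| + |c 1|) * (b + b') < 0) :
    ¬ 0 ≤ κ.eval P + ∑ i, c i * ((![μ, ν] : Fin 2 → EntropyForm n) i).eval P := by
  have h2 : 0 < Real.log 2 := Real.log_pos one_lt_two
  have e : κ.eval P + ∑ i, c i * ((![μ, ν] : Fin 2 → EntropyForm n) i).eval P =
      (a + c 0 * b + c 1 * b') / Real.log 2 := by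
    rw [Fin.sum_univ_two]
    simp only [Matrix.cons_val_zero, Matrix.cons_val_one, ha, hb, hb']
    ring
  rw [e, not_le]
  refine div_neg_of_neg_of_pos ?_ h2
  nlinarith [mul_le_mul_of_nonneg_right (le_abs_self (c 0)) hb0,
    mul_le_mul_of_nonneg_right (le_abs_self (c 1)) hb0', mul_nonneg (abs_nonneg (c 0)) hb0',
    mul_nonneg (abs_nonneg (c 1)) hb0]

theorem exists_rare_and (K : ℝ) (hK : 0 ≤ K) : ∃ (w : Fin 5 → ℝ) (A B C D : Fin 5 → Bool),
    (∀ ω, 0 ≤ w ω) ∧ ∑ ω, w ω = 1 ∧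
      ingleton w A B C D + K * (cmi w A B C + mutInfo w A B) < 0 := by
  -- With e(1 + K) = 1/16 the quadratic terms sum to at most (9/64 + 1/48) e, below the gain e/4.
  set e : ℝ := 1 / (16 * (1 + K)) with he
  have hpos : 0 < e := by positivity
  have heK : e * (1 + K) = 1 / 16 := by rw [he]; field_simp
  have hlt : e < 1 := by nlinarith
  obtain ⟨h1, h2⟩ := rare_and_bounds hpos hlt
  have h3 := cmi_rare_and ((1 - e) / 4) e (by linarith)
  refine ⟨![(1 - e) / 4, (1 - e) / 4, (1 - e) / 4, (1 - e) / 4, e],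
    ![false, false, true, true, true], ![false, true, false, true, true],
    ![false, false, false, false, true], ![false, true, true, true, true], ?_, ?_, ?_⟩
  · have : 0 ≤ (1 - e) / 4 := by linarith
    simp [Fin.forall_fin_succ, this, hpos.le]
  · simp [Fin.sum_univ_succ]
    ring
  · rw [h3, zero_add]
    have := mul_le_mul_of_nonneg_left h1 hK
    have h4 : e ^ 2 * (1 + K) = e / 16 := by rw [sq, mul_assoc, heK]; ring
    have h5 : e ^ 2 ≤ e / 16 := by rw [← h4]; nlinarith [sq_nonneg e]
    nlinarith

theorem exists_condIndep (K : ℝ) (hK : 0 ≤ K) : ∃ (w : Fin 4 → ℝ) (A B C D : Fin 4 → Bool),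
    (∀ ω, 0 ≤ w ω) ∧ ∑ ω, w ω = 1 ∧
      shannon w (fun ω => (A ω, B ω, C ω)) - shannon w (fun ω => (A ω, B ω)) = 0 ∧
      ingleton w A B C D + K * (cmi w A B C + cmi w B D C) < 0 := by
  obtain ⟨y, hy, hy', h⟩ := exists_and_or K hK
  obtain ⟨h1, h2, h3, -⟩ := and_or_bounds hy hy'
  refine ⟨![1 / 4, y, 1 / 2 - y, 1 / 4], ![false, false, true, true], ![false, true, false, true],
    ![false, false, false, true], ![false, true, true, true], ?_, ?_, shannon_and_sub _ _ _ _, ?_⟩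
  · have : 0 ≤ 1 / 2 - y := by linarith
    simp only [Fin.forall_fin_succ, Matrix.cons_val_zero, Matrix.cons_val_succ]
    exact ⟨by norm_num, hy.le, this, by norm_num, fun i => i.elim0⟩
  · simp [Fin.sum_univ_succ]
    ring
  · have := mul_le_mul_of_nonneg_left (add_le_add h2 h3) hK
    linarith

theorem exists_markov_right (K : ℝ) (hK : 0 ≤ K) : ∃ (w : Fin 4 → ℝ) (A B C D : Fin 4 → Bool),
    (∀ ω, 0 ≤ w ω) ∧ ∑ ω, w ω = 1 ∧
      ingleton w A B C D + K * (cmi w B C D + cmi w C D B) < 0 := by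
  obtain ⟨y, hy, hy', h⟩ := exists_and_or K hK
  obtain ⟨h1, -, -, h2⟩ := and_or_bounds hy hy'
  -- The two inputs are exchanged, so that B agrees with D, and the second input with C, outside the
  -- outcome of weight y.
  refine ⟨![1 / 4, y, 1 / 2 - y, 1 / 4], ![false, true, false, true], ![false, false, true, true],
    ![false, false, false, true], ![false, true, true, true], ?_, ?_, ?_⟩
  · have : 0 ≤ 1 / 2 - y := by linarith
    simp only [Fin.forall_fin_succ, Matrix.cons_val_zero, Matrix.cons_val_succ]
    exact ⟨by norm_num, hy.le, this, by norm_num, fun i => i.elim0⟩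
  · simp [Fin.sum_univ_succ]
    ring
  · rw [ingleton_and_or_swap, cmi_and_or_input, add_zero]
    have := mul_le_mul_of_nonneg_left h2 hK
    nlinarith

theorem exists_markov_left (K : ℝ) (hK : 0 ≤ K) : ∃ (w : Fin 6 → ℝ) (A B C D : Fin 6 → Bool),
    (∀ ω, 0 ≤ w ω) ∧ ∑ ω, w ω = 1 ∧
      ingleton w A B C D + K * (cmi w A D C + cmi w A C D) < 0 := by
  -- With x(1 + K) = 1/64 the cubic terms 4x³(1 + K) equal x²/16, below the gain x²/8.
  set x : ℝ := 1 / (64 * (1 + K)) with hx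
  have hpos : 0 < x := by positivity
  have hxK : x * (1 + K) = 1 / 64 := by rw [hx]; field_simp
  have hlt : x ≤ 1 / 2 := by nlinarith
  obtain ⟨h1, h2, h3⟩ := crossing_bounds hpos hlt
  refine ⟨![1 / 4, (1 - x) / 4, (1 - x) / 4, 1 / 4, x / 4, x / 4],
    ![false, false, true, true, false, true], ![false, true, false, true, true, false],
    ![false, true, false, true, false, false], ![false, true, false, true, true, true], ?_, ?_, ?_⟩
  · have : 0 ≤ (1 - x) / 4 := by linarith
    have hx4 : 0 ≤ x / 4 := by linarith
    simp [Fin.forall_fin_succ, this, hx4]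
  · simp [Fin.sum_univ_succ]
    ring
  · have := mul_le_mul_of_nonneg_left (add_le_add h2 h3) hK
    have h4 : x ^ 3 * (1 + K) = x ^ 2 / 64 := by
      rw [show x ^ 3 * (1 + K) = x ^ 2 * (x * (1 + K)) by ring, hxK]
      ring
    have h5 : 0 < x ^ 2 := by positivity
    linarith

theorem forall_two_eq_zero {n : ℕ} {μ ν : EntropyForm n} {P : JointDist n}
    (h : ∀ i, ((![μ, ν] : Fin 2 → EntropyForm n) i).eval P = 0) : μ.eval P = 0 ∧ ν.eval P = 0 :=
  ⟨h 0, h 1⟩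

theorem essentiallyConditional_of_indep :
    IsEssentiallyConditional (n := 4) (box 0 1 2 3) ![condMutualInfo 0 1 2, mutualInfo 0 1] := by
  refine ⟨fun P h => ?_, fun c => ?_⟩
  · obtain ⟨h1, h2⟩ := forall_two_eq_zero h
    exact box_nonneg_of_indep P 3 h1 h2
  · obtain ⟨w, A, B, C, D, hw, hw1, h⟩ := exists_rare_and (|c 0| + |c 1|) (by positivity)
    have hP := JointDist.realizes_ofVariables (V := fun _ => Bool) w hw hw1 ![A, B, C, D]
    exact ⟨_, eval_combination_neg (hP.eval_box 0 1 2 3) (hP.eval_condMutualInfo 0 1 2)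
      (hP.eval_mutualInfo 0 1) (cmi_nonneg hw _ _ _) (mutInfo_nonneg hw hw1 _ _) c h⟩

theorem essentiallyConditional_of_condIndep_condIndep :
    IsEssentiallyConditional (n := 4) (box 0 1 2 3)
      ![condMutualInfo 0 1 2, condMutualInfo 1 3 2] := by
  refine ⟨fun P h => ?_, fun c => ?_⟩
  · obtain ⟨h1, h2⟩ := forall_two_eq_zero h
    exact box_nonneg_of_condIndep_condIndep P h1 h2
  · obtain ⟨w, A, B, C, D, hw, hw1, -, h⟩ := exists_condIndep (|c 0| + |c 1|) (by positivity)
    have hP := JointDist.realizes_ofVariables (V := fun _ => Bool) w hw hw1 ![A, B, C, D]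
    exact ⟨_, eval_combination_neg (hP.eval_box 0 1 2 3) (hP.eval_condMutualInfo 0 1 2)
      (hP.eval_condMutualInfo 1 3 2) (cmi_nonneg hw _ _ _) (cmi_nonneg hw _ _ _) c h⟩

theorem essentiallyConditional_of_determined :
    IsEssentiallyConditional (n := 4) (box 0 1 2 3)
      ![condMutualInfo 0 1 2, condEnt₂ 2 0 1] := by
  refine ⟨fun P h => ?_, fun c => ?_⟩
  · obtain ⟨h1, h2⟩ := forall_two_eq_zero h
    exact box_nonneg_of_determined P 3 h1 h2
  · obtain ⟨w, A, B, C, D, hw, hw1, h0, h⟩ := exists_condIndep (|c 0| + |c 1|) (by positivity)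
    have hP := JointDist.realizes_ofVariables (V := fun _ => Bool) w hw hw1 ![A, B, C, D]
    refine ⟨_, eval_combination_neg (hP.eval_box 0 1 2 3) (hP.eval_condMutualInfo 0 1 2)
      (hP.eval_condEnt₂ 2 0 1) (cmi_nonneg hw _ _ _) h0.ge c ?_⟩
    refine lt_of_le_of_lt ?_ h
    -- The conditional entropy is 0 in this example, so it may replace I(B:D|C) ≥ 0 in the bound.
    have := cmi_nonneg hw B D C
    refine add_le_add le_rfl (mul_le_mul_of_nonneg_left (add_le_add le_rfl ?_) (by positivity))
    exact h0.le.trans this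

theorem essentiallyConditional_markov_left :
    IsEssentiallyConditional (n := 4) (box 0 1 2 3)
      ![condMutualInfo 0 3 2, condMutualInfo 0 2 3] := by
  refine ⟨fun P h => ?_, fun c => ?_⟩
  · obtain ⟨h1, h2⟩ := forall_two_eq_zero h
    exact box_nonneg_of_markov_left P 1 h1 h2
  · obtain ⟨w, A, B, C, D, hw, hw1, h⟩ := exists_markov_left (|c 0| + |c 1|) (by positivity)
    have hP := JointDist.realizes_ofVariables (V := fun _ => Bool) w hw hw1 ![A, B, C, D]
    exact ⟨_, eval_combination_neg (hP.eval_box 0 1 2 3) (hP.eval_condMutualInfo 0 3 2)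
      (hP.eval_condMutualInfo 0 2 3) (cmi_nonneg hw _ _ _) (cmi_nonneg hw _ _ _) c h⟩

theorem essentiallyConditional_markov_right :
    IsEssentiallyConditional (n := 4) (box 0 1 2 3)
      ![condMutualInfo 1 2 3, condMutualInfo 2 3 1] := by
  refine ⟨fun P h => ?_, fun c => ?_⟩
  · obtain ⟨h1, h2⟩ := forall_two_eq_zero h
    exact box_nonneg_of_markov_right P 0 h1 h2
  · obtain ⟨w, A, B, C, D, hw, hw1, h⟩ := exists_markov_right (|c 0| + |c 1|) (by positivity)
    have hP := JointDist.realizes_ofVariables (V := fun _ => Bool) w hw hw1 ![A, B, C, D]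
    exact ⟨_, eval_combination_neg (hP.eval_box 0 1 2 3) (hP.eval_condMutualInfo 1 2 3)
      (hP.eval_condMutualInfo 2 3 1) (cmi_nonneg hw _ _ _) (cmi_nonneg hw _ _ _) c h⟩

/-- Two conditional mutual informations that vanish for the given variables may be added to the
Ingleton expression. -/
theorem Realizes.eval_box_add_add {Ω : Type} [Fintype Ω] {n : ℕ} {V : Fin n → Type} {w : Ω → ℝ}
    {X : ∀ i, Ω → V i} {P : JointDist n} (hP : Realizes w X P) (i j k l i₁ j₁ k₁ i₂ j₂ k₂ : Fin n)
    (h₁ : cmi w (X i₁) (X j₁) (X k₁) = 0)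
    (h₂ : cmi w (X i₂) (X j₂) (X k₂) = 0) :
    (box i j k l + condMutualInfo i₁ j₁ k₁ + condMutualInfo i₂ j₂ k₂).eval P =
      ingleton w (X i) (X j) (X k) (X l) / Real.log 2 := by
  rw [eval_add, eval_add, hP.eval_box, hP.eval_condMutualInfo, hP.eval_condMutualInfo, h₁, h₂]
  ring

theorem eval_box_add_add_nonneg {n : ℕ} {P : JointDist n} {i j k l : Fin n}
    (h : 0 ≤ (box i j k l).eval P) (i₁ j₁ k₁ i₂ j₂ k₂ : Fin n) :
    0 ≤ (box i j k l + condMutualInfo i₁ j₁ k₁ + condMutualInfo i₂ j₂ k₂).eval P := by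
  rw [eval_add, eval_add]
  exact add_nonneg (add_nonneg h (P.realizes.eval_condMutualInfo_nonneg _ _ _))
    (P.realizes.eval_condMutualInfo_nonneg _ _ _)

/-- The fifth variable of the example repeats the third one. -/
theorem essentiallyConditional_markov_left_five :
    IsEssentiallyConditional (n := 5)
      (box 0 1 2 3 + condMutualInfo 0 2 4 + condMutualInfo 0 4 2)
      ![condMutualInfo 0 3 2, condMutualInfo 0 2 3] := by
  refine ⟨fun P h => ?_, fun c => ?_⟩
  · obtain ⟨h1, h2⟩ := forall_two_eq_zero h
    exact eval_box_add_add_nonneg (box_nonneg_of_markov_left P 1 h1 h2) _ _ _ _ _ _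
  · obtain ⟨w, A, B, C, D, hw, hw1, h⟩ := exists_markov_left (|c 0| + |c 1|) (by positivity)
    have hP := JointDist.realizes_ofVariables (V := fun _ => Bool) w hw hw1 ![A, B, C, D, C]
    exact ⟨_, eval_combination_neg (hP.eval_box_add_add 0 1 2 3 0 2 4 0 4 2 (cmi_self_right hw A C)
      (cmi_self_right hw A C)) (hP.eval_condMutualInfo 0 3 2)
      (hP.eval_condMutualInfo 0 2 3) (cmi_nonneg hw _ _ _) (cmi_nonneg hw _ _ _) c h⟩

/-- The fifth variable of the example repeats the second one. -/
theorem essentiallyConditional_markov_right_five :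
    IsEssentiallyConditional (n := 5)
      (box 0 1 2 3 + condMutualInfo 1 2 4 + condMutualInfo 2 4 1)
      ![condMutualInfo 1 2 3, condMutualInfo 2 3 1] := by
  refine ⟨fun P h => ?_, fun c => ?_⟩
  · obtain ⟨h1, h2⟩ := forall_two_eq_zero h
    exact eval_box_add_add_nonneg (box_nonneg_of_markov_right P 0 h1 h2) _ _ _ _ _ _
  · obtain ⟨w, A, B, C, D, hw, hw1, h⟩ := exists_markov_right (|c 0| + |c 1|) (by positivity)
    have hP := JointDist.realizes_ofVariables (V := fun _ => Bool) w hw hw1 ![A, B, C, D, B]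
    exact ⟨_, eval_combination_neg (hP.eval_box_add_add 0 1 2 3 1 2 4 2 4 1 (cmi_self_left hw C B)
      (cmi_self_right hw C B)) (hP.eval_condMutualInfo 1 2 3)
      (hP.eval_condMutualInfo 2 3 1) (cmi_nonneg hw _ _ _) (cmi_nonneg hw _ _ _) c h⟩

/-- The fifth variable of the example repeats the fourth one. -/
theorem essentiallyConditional_markov_right_five' :
    IsEssentiallyConditional (n := 5)
      (box 0 1 2 3 + condMutualInfo 2 3 4 + condMutualInfo 2 4 3)
      ![condMutualInfo 1 2 3, condMutualInfo 2 3 1] := by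
  refine ⟨fun P h => ?_, fun c => ?_⟩
  · obtain ⟨h1, h2⟩ := forall_two_eq_zero h
    exact eval_box_add_add_nonneg (box_nonneg_of_markov_right P 0 h1 h2) _ _ _ _ _ _
  · obtain ⟨w, A, B, C, D, hw, hw1, h⟩ := exists_markov_right (|c 0| + |c 1|) (by positivity)
    have hP := JointDist.realizes_ofVariables (V := fun _ => Bool) w hw hw1 ![A, B, C, D, D]
    exact ⟨_, eval_combination_neg (hP.eval_box_add_add 0 1 2 3 2 3 4 2 4 3 (cmi_self_right hw C D)
      (cmi_self_right hw C D)) (hP.eval_condMutualInfo 1 2 3)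
      (hP.eval_condMutualInfo 2 3 1) (cmi_nonneg hw _ _ _) (cmi_nonneg hw _ _ _) c h⟩

end EssentiallyConditional

/-- In each line the variables `A, B, C, D` (and `E`, where it occurs) have the indices
`0, 1, 2, 3` (and `4`); the constraints are the entries of the vector `![…, …]`. -/
theorem theorem3 :
    -- if I(A:B|C) = I(A:B) = 0, then □_{AB,CD} ≥ 0
    IsEssentiallyConditional (n := 4) (box 0 1 2 3)
      ![condMutualInfo 0 1 2, mutualInfo 0 1] ∧
    -- if I(A:B|C) = I(B:D|C) = 0, then □_{AB,CD} ≥ 0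
    IsEssentiallyConditional (n := 4) (box 0 1 2 3)
      ![condMutualInfo 0 1 2, condMutualInfo 1 3 2] ∧
    -- if I(A:B|C) = H(C|A,B) = 0, then □_{AB,CD} ≥ 0
    IsEssentiallyConditional (n := 4) (box 0 1 2 3)
      ![condMutualInfo 0 1 2, condEnt₂ 2 0 1] ∧
    -- if I(A:D|C) = I(A:C|D) = 0, then □_{AB,CD} + I(A:C|E) + I(A:E|C) ≥ 0
    IsEssentiallyConditional (n := 5)
      (box 0 1 2 3 + condMutualInfo 0 2 4 + condMutualInfo 0 4 2)
      ![condMutualInfo 0 3 2, condMutualInfo 0 2 3] ∧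
    -- if I(B:C|D) = I(C:D|B) = 0, then □_{AB,CD} + I(B:C|E) + I(C:E|B) ≥ 0
    IsEssentiallyConditional (n := 5)
      (box 0 1 2 3 + condMutualInfo 1 2 4 + condMutualInfo 2 4 1)
      ![condMutualInfo 1 2 3, condMutualInfo 2 3 1] ∧
    -- if I(B:C|D) = I(C:D|B) = 0, then □_{AB,CD} + I(C:D|E) + I(C:E|D) ≥ 0
    IsEssentiallyConditional (n := 5)
      (box 0 1 2 3 + condMutualInfo 2 3 4 + condMutualInfo 2 4 3)
      ![condMutualInfo 1 2 3, condMutualInfo 2 3 1] ∧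
    -- if I(A:D|C) = I(A:C|D) = 0, then □_{AB,CD} ≥ 0
    IsEssentiallyConditional (n := 4) (box 0 1 2 3)
      ![condMutualInfo 0 3 2, condMutualInfo 0 2 3] ∧
    -- if I(B:C|D) = I(C:D|B) = 0, then □_{AB,CD} ≥ 0
    IsEssentiallyConditional (n := 4) (box 0 1 2 3)
      ![condMutualInfo 1 2 3, condMutualInfo 2 3 1] := by
  exact ⟨essentiallyConditional_of_indep, essentiallyConditional_of_condIndep_condIndep,
    essentiallyConditional_of_determined, essentiallyConditional_markov_left_five,
    essentiallyConditional_markov_right_five, essentiallyConditional_markov_right_five',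
    essentiallyConditional_markov_left, essentiallyConditional_markov_right⟩
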